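/- **Theorem.** Let $(K,\delta)$ be a differential field of characteristic zero and let $X$ be a smooth $K$-scheme. *Notation.* For a $K$-algebra $A$ let $\Omega^\tau_{A/K}$ be the $A$-module generated by the symbols $1$ and $d^\tau a$ ($a\in A$), subject to $d^\tau(a+b)=d^\tau a+d^\tau b$, $d^\tau(ab)=a\,d^\tau b+b\,d^\tau a$, and $d^\tau c=\delta(c)\cdot 1$ for $c\in K$. Let $\Omega^\tau_{X/K}$ (the sheaf of KS-forms) be the sheaf on $X$ associated to $U\mapsto\Omega^\tau_{\mathcal O(U)/K}$, and let $\iota:\mathcal O_X\to\Omega^\tau_{X/K}$, $g\mapsto g\cdot 1$, and $\lambda:\Omega^\tau_{X/K}\to\Omega_{X/K}$, $1\mapsto 0$, $d^\tau a\mapsto da$. Let $T_{X/K}$ be the tangent sheaf of $K$-linear derivations of $\mathcal O_X$ and $\mathcal D$ the sheaf of pairs $(g,D)$ where $g$ is a local function and $D$ is a derivation of $\mathcal O_X$ (over an open set) with $D(c)=g\,\delta(c)$ for all $c\in K$. The Kodaira–Spencer class $\mathrm{KS}_X(\delta)\in H^1(X,T_{X/K})$ is the image of $1$ under the connecting map of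 the exact sequence $0\to T_{X/K}\to\mathcal D\to\mathcal O_X\to 0$ (with maps $D\mapsto(0,D)$ and $(g,D)\mapsto g$); that is, it is the class of $(\delta_i-\delta_j)$ when $\delta_i$ are derivations of $\mathcal O_{U_i}$ extending $\delta$, for an open cover $(U_i)$ of $X$. For $\omega\in H^0(X,\Omega_{X/K})$, the class $\mathrm{KS}_X(\delta)\smile\omega\in H^1(X,\mathcal O_X)$ is the image of $\mathrm{KS}_X(\delta)$ under the map induced by contraction $\langle\cdot,\omega\rangle:T_{X/K}\to\mathcal O_X$. *Claim.* Let $\omega\in H^0(X,\Omega_{X/K})$. 1. There is $\eta\in H^0(X,\Omega^\tau_{X/K})$ with $\lambda(\eta)=\omega$ if and only if $\mathrm{KS}_X(\delta)\smile\omega=0$. 2. The sequence $0\to\mathcal O_X\xrightarrow{\iota}\Omega^\tau_{X/K}\xrightarrow{\lambda}\Omega_{X/K}\to 0$ is exact, and its connecting map $c:H^0(X,\Omega_{X/K})\to H^1(X,\mathcal O_X)$ satisfies $c(\omega)=-\mathrm{KS}_X(\delta)\smile\omega$ (with the same sign convention for the connecting maps of both exact sequences). 3. Let $(U_i)$ be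 an open cover of $X$ with derivations $\delta_i$ of the sheaf of rings $\mathcal O_{U_i}$ extending $\delta$, and let $t_{ij}=\delta_i-\delta_j\in T_{X/K}(U_i\cap U_j)$. There are splittings (as sheaves of abelian groups) $\sigma_i:\Omega_{U_i/K}\to\Omega^\tau_{X/K}|_{U_i}$ of $\lambda|_{U_i}$ with $\sigma_i(a\,db)=a\,(d^\tau b-\delta_i(b)\cdot 1)$, and $\sigma_i(\omega)-\sigma_j(\omega)=-\iota(\langle t_{ij},\omega\rangle)$ on $U_i\cap U_j$ for all $i,j$. Moreover $\mathrm{KS}_X(\delta)\smile\omega=0$ if and only if there are $g_i\in\mathcal O(U_i)$ with $\langle t_{ij},\omega\rangle=g_i-g_j$ on $U_i\cap U_j$ for all $i,j$. -/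

import Mathlib

open CategoryTheory AlgebraicGeometry TopologicalSpace Opposite

universe u

namespace KSForms

section Algebra

variable {K : Type u} [CommRing K] (δ : Derivation ℤ K K)
variable (A : Type u) [CommRing A] [Algebra K A]

/-- The defining relations of `Ω^τ_{A/K}` on the free `A`-module with basis the symbol `1`
(the index `none`) and the symbols `d^τ a` (the index `some a`) for `a ∈ A`: additivity, the Leibniz
rule, and `d^τ c = δ(c) · 1` for `c ∈ K`. -/
inductive KSRel : (Option A →₀ A) → Prop
  | add (a b : A) : KSRel (.single (some (a + b)) 1 - .single (some a) 1 - .single (some b) 1)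
  | mul (a b : A) : KSRel (.single (some (a * b)) 1 - .single (some b) a - .single (some a) b)
  | const (c : K) : KSRel
      (.single (some (algebraMap K A c)) 1 - .single none (algebraMap K A (δ c)))

/-- The module `Ω^τ_{A/K}` of KS-forms of a `K`-algebra `A`. -/
def KSModule : Type u := (Option A →₀ A) ⧸ Submodule.span A {r | KSRel δ A r}

noncomputable instance : AddCommGroup (KSModule δ A) :=
  inferInstanceAs (AddCommGroup ((Option A →₀ A) ⧸ Submodule.span A {r | KSRel δ A r}))

noncomputable instance : Module A (KSModule δ A) :=
  inferInstanceAs (Module A ((Option A →₀ A) ⧸ Submodule.span A {r | KSRel δ A r}))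

namespace KSModule

/-- The quotient map from the free module on the symbols `1` and `d^τ a`. -/
noncomputable def mk : (Option A →₀ A) →ₗ[A] KSModule δ A :=
  Submodule.mkQ (Submodule.span A {r | KSRel δ A r})

/-- The KS-form `1`. -/
noncomputable def unit : KSModule δ A := mk δ A (.single none 1)

variable {A}

/-- The KS-form `d^τ a`. -/
noncomputable def dτ (a : A) : KSModule δ A := mk δ A (.single (some a) 1)

variable {δ}

lemma mk_eq_zero {r : Option A →₀ A} (h : KSRel δ A r) : mk δ A r = 0 :=
  (Submodule.Quotient.mk_eq_zero _).2 (Submodule.subset_span h)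

lemma mk_single_some (a b : A) : mk δ A (.single (some a) b) = b • dτ δ a := by
  rw [dτ, ← map_smul, Finsupp.smul_single, smul_eq_mul, mul_one]

lemma mk_single_none (b : A) : mk δ A (.single none b) = b • unit δ A := by
  rw [unit, ← map_smul, Finsupp.smul_single, smul_eq_mul, mul_one]

lemma dτ_add (a b : A) : dτ δ (a + b) = dτ δ a + dτ δ b := by
  have := mk_eq_zero (KSRel.add (δ := δ) a b)
  rwa [map_sub, map_sub, sub_sub, sub_eq_zero] at this

lemma dτ_mul (a b : A) : dτ δ (a * b) = a • dτ δ b + b • dτ δ a := by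
  have := mk_eq_zero (KSRel.mul (δ := δ) a b)
  rw [map_sub, map_sub, mk_single_some a b, mk_single_some b a, sub_sub, sub_eq_zero] at this
  exact this

lemma dτ_const (c : K) : dτ δ (algebraMap K A c) = algebraMap K A (δ c) • unit δ A := by
  have := mk_eq_zero (KSRel.const (δ := δ) (A := A) c)
  rwa [map_sub, mk_single_none, sub_eq_zero] at this

section lift

variable {M : Type*} [AddCommGroup M] [Module A M] (m : M) (d : A → M)
  (d_add : ∀ a b, d (a + b) = d a + d b)
  (d_mul : ∀ a b, d (a * b) = a • d b + b • d a)
  (d_const : ∀ c : K, d (algebraMap K A c) = algebraMap K A (δ c) • m)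

/-- The universal property of `Ω^τ_{A/K}`. -/
noncomputable def lift : KSModule δ A →ₗ[A] M :=
  Submodule.liftQ _ (Finsupp.linearCombination A (fun o : Option A => o.elim m d)) <| by
    rw [Submodule.span_le]
    rintro r (⟨a, b⟩ | ⟨a, b⟩ | c)
    · simp [d_add]
    · simp [d_mul]
    · simp [d_const]

@[simp] lemma lift_unit : lift m d d_add d_mul d_const (unit δ A) = m :=
  (Submodule.liftQ_apply _ _ _).trans (by simp)

@[simp] lemma lift_dτ (a : A) : lift m d d_add d_mul d_const (dτ δ a) = d a :=
  (Submodule.liftQ_apply _ _ _).trans (by simp)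

end lift

lemma addHom_ext {M : Type*} [AddCommGroup M] {f g : KSModule δ A →+ M}
    (h₁ : ∀ a : A, f (a • unit δ A) = g (a • unit δ A))
    (h₂ : ∀ a b : A, f (a • dτ δ b) = g (a • dτ δ b)) : f = g := by
  have : f.comp (mk δ A).toAddMonoidHom = g.comp (mk δ A).toAddMonoidHom := by
    refine Finsupp.addHom_ext ?_
    rintro (_ | b) a
    · simpa [mk_single_none] using h₁ a
    · simpa [mk_single_some] using h₂ a b
  ext x
  obtain ⟨y, rfl⟩ := Submodule.mkQ_surjective _ x
  exact DFunLike.congr_fun this y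

variable {B : Type u} [CommRing B] [Algebra K B] {C : Type u} [CommRing C] [Algebra K C]

lemma map_aux (φ : A →ₐ[K] B) (c : K) :
    dτ δ (φ (algebraMap K A c)) = φ (algebraMap K A (δ c)) • unit δ B := by
  rw [AlgHom.commutes, AlgHom.commutes, dτ_const]

/-- Functoriality of `Ω^τ_{A/K}` in `A`: `a • 1 ↦ φ(a) • 1`, `a • d^τ b ↦ φ(a) • d^τ φ(b)`. -/
noncomputable def map (φ : A →ₐ[K] B) : KSModule δ A →+ KSModule δ B :=
  letI : Module A (KSModule δ B) := Module.compHom _ φ.toRingHom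
  (lift (δ := δ) (A := A) (M := KSModule δ B) (unit δ B) (fun a => dτ δ (φ a))
    (fun a b => (congrArg _ (map_add φ a b)).trans (dτ_add _ _))
    (fun a b => (congrArg _ (map_mul φ a b)).trans (dτ_mul _ _))
    (map_aux φ)).toAddMonoidHom

lemma map_smul (φ : A →ₐ[K] B) (a : A) (x : KSModule δ A) :
    map φ (a • x) = φ a • map φ x :=
  letI : Module A (KSModule δ B) := Module.compHom _ φ.toRingHom
  (lift (δ := δ) (A := A) (M := KSModule δ B) (unit δ B) (fun a => dτ δ (φ a))
    (fun a b => (congrArg _ (map_add φ a b)).trans (dτ_add _ _))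
    (fun a b => (congrArg _ (map_mul φ a b)).trans (dτ_mul _ _))
    (map_aux φ)).map_smul a x

lemma map_unit (φ : A →ₐ[K] B) : map φ (unit δ A) = unit δ B :=
  letI : Module A (KSModule δ B) := Module.compHom _ φ.toRingHom
  lift_unit (δ := δ) (A := A) (M := KSModule δ B) (unit δ B) (fun a => dτ δ (φ a))
    (fun a b => (congrArg _ (map_add φ a b)).trans (dτ_add _ _))
    (fun a b => (congrArg _ (map_mul φ a b)).trans (dτ_mul _ _))
    (map_aux φ)

lemma map_dτ (φ : A →ₐ[K] B) (a : A) : map φ (dτ δ a) = dτ δ (φ a) :=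
  letI : Module A (KSModule δ B) := Module.compHom _ φ.toRingHom
  lift_dτ (δ := δ) (A := A) (M := KSModule δ B) (unit δ B) (fun a => dτ δ (φ a))
    (fun a b => (congrArg _ (map_add φ a b)).trans (dτ_add _ _))
    (fun a b => (congrArg _ (map_mul φ a b)).trans (dτ_mul _ _))
    (map_aux φ) a

lemma map_id : map (δ := δ) (AlgHom.id K A) = AddMonoidHom.id _ :=
  addHom_ext (fun a => by simp [map_smul, map_unit]) (fun a b => by simp [map_smul, map_dτ])

lemma map_comp (φ : A →ₐ[K] B) (ψ : B →ₐ[K] C) :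
    map (δ := δ) (ψ.comp φ) = (map ψ).comp (map φ) :=
  addHom_ext (fun a => by simp [map_smul, map_unit]) (fun a b => by simp [map_smul, map_dτ])

variable (δ A)

/-- The map `λ : Ω^τ_{A/K} → Ω_{A/K}`, `1 ↦ 0`, `d^τ a ↦ da`. -/
noncomputable def toKaehler : KSModule δ A →ₗ[A] Ω[A⁄K] :=
  lift 0 (KaehlerDifferential.D K A) (by simp) (by simp) (by simp)

/-- The map `ι : A → Ω^τ_{A/K}`, `a ↦ a • 1`. -/
noncomputable def ofFun : A →+ KSModule δ A :=
  (LinearMap.toSpanSingleton A (KSModule δ A) (unit δ A)).toAddMonoidHom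

lemma toKaehler_ofFun (a : A) : toKaehler δ A (ofFun δ A a) = 0 := by
  change toKaehler δ A (a • unit δ A) = 0
  rw [_root_.map_smul, toKaehler, lift_unit, smul_zero]

end KSModule

section Kaehler
variable {A}
variable {B : Type u} [CommRing B] [Algebra K B] {C : Type u} [CommRing C] [Algebra K C]

/-- Functoriality of `Ω_{A/K}` in `A`. -/
noncomputable def kaehlerMap (φ : A →ₐ[K] B) : Ω[A⁄K] →+ Ω[B⁄K] :=
  letI : Algebra A B := φ.toRingHom.toAlgebra
  haveI : IsScalarTower K A B := .of_algebraMap_eq fun c => (φ.commutes c).symm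
  (KaehlerDifferential.map K K A B).toAddMonoidHom

lemma kaehlerMap_smul (φ : A →ₐ[K] B) (a : A) (x : Ω[A⁄K]) :
    kaehlerMap φ (a • x) = φ a • kaehlerMap φ x := by
  let : Algebra A B := φ.toRingHom.toAlgebra
  have : IsScalarTower K A B := .of_algebraMap_eq fun c => (φ.commutes c).symm
  refine (LinearMap.map_smul (KaehlerDifferential.map K K A B) a x).trans ?_
  rw [algebra_compatible_smul B a]; rfl

lemma kaehlerMap_D (φ : A →ₐ[K] B) (a : A) :
    kaehlerMap φ (KaehlerDifferential.D K A a) = KaehlerDifferential.D K B (φ a) := by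
  let : Algebra A B := φ.toRingHom.toAlgebra
  have : IsScalarTower K A B := .of_algebraMap_eq fun c => (φ.commutes c).symm
  exact KaehlerDifferential.map_D K K A B a

lemma kaehler_addHom_ext {M : Type*} [AddCommGroup M] {f g : Ω[A⁄K] →+ M}
    (h : ∀ a b : A, f (a • KaehlerDifferential.D K A b) = g (a • KaehlerDifferential.D K A b)) :
    f = g := by
  ext x
  have hx : x ∈ Submodule.span A (Set.range (KaehlerDifferential.D K A)) := by
    rw [KaehlerDifferential.span_range_derivation]; trivial
  induction hx using Submodule.closure_induction with
  | zero => simp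
  | add x y _ _ hx hy => simp [hx, hy]
  | smul_mem a x hx => obtain ⟨b, rfl⟩ := hx; exact h a b

lemma kaehlerMap_id : kaehlerMap (AlgHom.id K A) = AddMonoidHom.id _ :=
  kaehler_addHom_ext (fun a b => by simp [kaehlerMap_smul, kaehlerMap_D])

lemma kaehlerMap_comp (φ : A →ₐ[K] B) (ψ : B →ₐ[K] C) :
    kaehlerMap (ψ.comp φ) = (kaehlerMap ψ).comp (kaehlerMap φ) :=
  kaehler_addHom_ext (fun a b => by simp [kaehlerMap_smul, kaehlerMap_D])

lemma KSModule.map_smul_unit (φ : A →ₐ[K] B) (a : A) :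
    KSModule.map φ (a • KSModule.unit δ A) = φ a • KSModule.unit δ B := by
  rw [map_smul, map_unit]

lemma KSModule.toKaehler_map (φ : A →ₐ[K] B) :
    (KSModule.toKaehler δ B).toAddMonoidHom.comp (KSModule.map φ) =
      (kaehlerMap φ).comp (KSModule.toKaehler δ A).toAddMonoidHom :=
  KSModule.addHom_ext (fun a => by simp [map_smul, map_unit, toKaehler])
    (fun a b => by simp [map_smul, map_dτ, toKaehler, kaehlerMap_smul, kaehlerMap_D])

end Kaehler

section Existence
/-- The ring homomorphism `a ↦ φ(a) + d(a) ε`. -/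
def toDual {A B : Type u} [CommRing A] [CommRing B] (φ : A →+* B) (d : A →+ B)
    (h : ∀ a b, d (a * b) = φ a * d b + φ b * d a) : A →+* TrivSqZeroExt B B where
  toFun a := .inl (φ a) + .inr (d a)
  map_one' := by
    have h1 : d 1 = 0 := by simpa using h 1 1
    simp [h1]
  map_zero' := by simp
  map_add' a b := by ext <;> simp
  map_mul' a b := by
    ext
    · simp
    · simp [h]; ring

/-- The derivation given by a ring homomorphism `a ↦ a + d(a) ε`. -/
def ofDual {A : Type u} [CommRing A] (g : A →+* TrivSqZeroExt A A)
    (hg : ∀ a, (g a).fst = a) : Derivation ℤ A A :=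
  Derivation.mk' (AddMonoidHom.toIntLinearMap
    { toFun := fun a => (g a).snd
      map_zero' := by simp
      map_add' := fun a b => by simp }) (fun a b => by
        simp [hg, mul_comm])

lemma exists_derivation_of_formallySmooth (A : Type u) [CommRing A] [Algebra K A]
    [Algebra.FormallySmooth K A] :
    ∃ D : Derivation ℤ A A, ∀ c : K, D (algebraMap K A c) = algebraMap K A (δ c) := by
  let e : K →+* TrivSqZeroExt A A := toDual (algebraMap K A)
    ((algebraMap K A).toAddMonoidHom.comp δ.toLinearMap.toAddMonoidHom) (fun a b => by simp)
  obtain ⟨B, _, hB⟩ : ∃ (B : Type u) (_ : CommRing B), Nonempty (B ≃+* TrivSqZeroExt A A) :=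
    ⟨TrivSqZeroExt A A, inferInstance, ⟨RingEquiv.refl _⟩⟩
  obtain ⟨i⟩ := hB
  let : Algebra K B := (i.symm.toRingHom.comp e).toAlgebra
  let p : B →ₐ[K] A :=
    { toRingHom := (TrivSqZeroExt.fstHom A A A).toRingHom.comp i.toRingHom
      commutes' := fun c => by
        change TrivSqZeroExt.fst (i (i.symm (e c))) = _
        simp [e, toDual] }
  have hp : Function.Surjective p := fun a => ⟨i.symm (.inl a), by
    change TrivSqZeroExt.fst (i (i.symm (.inl a))) = _
    simp⟩
  have hn : IsNilpotent (RingHom.ker (p : B →+* A)) := by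
    refine ⟨2, ?_⟩
    rw [pow_two, Submodule.zero_eq_bot, eq_bot_iff, Ideal.mul_le]
    intro x hx y hy
    have hx : (i x).fst = 0 := hx
    have hy : (i y).fst = 0 := hy
    rw [Ideal.mem_bot, ← i.injective.eq_iff, map_zero, map_mul]
    ext <;> simp [hx, hy]
  let g := Algebra.FormallySmooth.liftOfSurjective (AlgHom.id K A) p hp hn
  have hg : ∀ a, p (g a) = a := fun a =>
    Algebra.FormallySmooth.liftOfSurjective_apply (AlgHom.id K A) p hp hn a
  refine ⟨ofDual (i.toRingHom.comp g.toRingHom) hg, fun c => ?_⟩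
  change (i (g (algebraMap K A c))).snd = _
  rw [g.commutes]
  change (i (i.symm (e c))).snd = _
  simp [e, toDual, Algebra.algebraMap_eq_smul_one]

lemma derivation_ext_of_isLocalization {A B C : Type u} [CommRing A] [CommRing B] [CommRing C]
    [Algebra A B] (M : Submonoid A) [IsLocalization M B] (ψ : B →+* C)
    (D₁ : Derivation ℤ B B) (D₂ : Derivation ℤ C C)
    (h : ∀ a : A, ψ (D₁ (algebraMap A B a)) = D₂ (ψ (algebraMap A B a))) (b : B) :
    ψ (D₁ b) = D₂ (ψ b) := by
  obtain ⟨⟨a, s⟩, hs⟩ := IsLocalization.surj M b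
  have hu : IsUnit (ψ (algebraMap A B s)) := (IsLocalization.map_units B s).map ψ
  have h1 := h a
  rw [← hs, D₁.leibniz, map_mul, D₂.leibniz] at h1
  simp only [smul_eq_mul, map_add, map_mul] at h1
  rw [h s] at h1
  exact hu.mul_left_cancel (add_left_cancel h1)

lemma exists_derivation_of_isLocalization {A B : Type u} [CommRing A] [CommRing B]
    [Algebra A B] (M : Submonoid A) [IsLocalization M B] (D : Derivation ℤ A A) :
    ∃ D' : Derivation ℤ B B, ∀ a, D' (algebraMap A B a) = algebraMap A B (D a) := by
  let e : A →+* TrivSqZeroExt B B := toDual (algebraMap A B)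
    ((algebraMap A B).toAddMonoidHom.comp D.toLinearMap.toAddMonoidHom) (fun a b => by simp)
  have he : ∀ s : M, IsUnit (e s) := fun s => by
    rw [TrivSqZeroExt.isUnit_iff_isUnit_fst]
    simpa [e, toDual] using IsLocalization.map_units B s
  let g : B →+* TrivSqZeroExt B B := IsLocalization.lift he
  have hg : ∀ b, (g b).fst = b := by
    have : (TrivSqZeroExt.fstHom B B B).toRingHom.comp g = RingHom.id B :=
      IsLocalization.ringHom_ext M (by ext a; simp [g, e, toDual])
    exact fun b => RingHom.congr_fun this b
  refine ⟨ofDual g hg, fun a => ?_⟩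
  change (g _).snd = _
  simp only [g, IsLocalization.lift_eq]
  simp [e, toDual, Algebra.algebraMap_eq_smul_one]

end Existence

end Algebra

section Scheme

variable {K : Type u} [CommRing K] (δ : Derivation ℤ K K)
variable {X : Scheme.{u}} (f : X ⟶ Spec (.of K))

/-- `O_X(U)`, as a `K`-algebra through the structure morphism `f : X → Spec K`. -/
def Sec (_f : X ⟶ Spec (.of K)) (U : X.Opens) : Type u := Γ(X, U)

instance (U : X.Opens) : CommRing (Sec f U) := inferInstanceAs (CommRing Γ(X, U))

noncomputable instance (U : X.Opens) : Algebra K (Sec f U) :=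
  ((f.appLE ⊤ U le_top).hom.comp (Scheme.ΓSpecIso (.of K)).inv.hom).toAlgebra

/-- Restriction of functions, as a homomorphism of `K`-algebras. -/
noncomputable def res {U V : X.Opens} (h : V ≤ U) : Sec f U →ₐ[K] Sec f V where
  toRingHom := (X.presheaf.map (homOfLE h).op).hom
  commutes' c :=
    congrArg (fun φ => φ.hom ((Scheme.ΓSpecIso (.of K)).inv.hom c))
      (f.appLE_map (U := ⊤) (V := U) le_top (homOfLE h).op)

lemma res_self (U : X.Opens) : res f (le_refl U) = AlgHom.id K _ := by
  ext a
  exact congrArg (fun φ => φ.hom a) (X.presheaf.map_id (op U))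

lemma res_comp {U V W : X.Opens} (h : V ≤ U) (h' : W ≤ V) :
    (res f h').comp (res f h) = res f (h'.trans h) := by
  ext a
  exact congrArg (fun φ => φ.hom a)
    (X.presheaf.map_comp (homOfLE h).op (homOfLE h').op).symm

lemma res_res {U V W : X.Opens} (h : V ≤ U) (h' : W ≤ V) (a : Sec f U) :
    res f h' (res f h a) = res f (h'.trans h) a :=
  DFunLike.congr_fun (res_comp f h h') a

lemma res_refl_apply {U : X.Opens} (a : Sec f U) : res f (le_refl U) a = a :=
  DFunLike.congr_fun (res_self f U) a

/-- The structure sheaf as a presheaf of abelian groups. -/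
noncomputable def structPre : (Opens X)ᵒᵖ ⥤ AddCommGrpCat.{u} where
  obj U := .of (Sec f U.unop)
  map i := AddCommGrpCat.ofHom (res f i.unop.le).toAddMonoidHom
  map_id U := by
    ext a
    exact res_refl_apply f a
  map_comp i j := by
    ext a
    exact (res_res f _ _ a).symm

lemma structPre_isSheaf : TopCat.Presheaf.IsSheaf (X := X) (structPre f) := by
  rw [TopCat.Presheaf.isSheaf_iff_isSheaf_comp (forget AddCommGrpCat)]
  exact (TopCat.Presheaf.isSheaf_iff_isSheaf_comp (forget CommRingCat) _).1 X.sheaf.property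

/-- The presheaf `U ↦ Ω_{O(U)/K}`. -/
noncomputable def omegaPre : (Opens X)ᵒᵖ ⥤ AddCommGrpCat.{u} where
  obj U := .of (Ω[Sec f U.unop⁄K])
  map i := AddCommGrpCat.ofHom (kaehlerMap (res f i.unop.le))
  map_id U := by
    ext : 1
    exact (congrArg kaehlerMap (res_self f _)).trans kaehlerMap_id
  map_comp i j := by
    ext : 1
    exact (congrArg kaehlerMap (res_comp f i.unop.le j.unop.le).symm).trans (kaehlerMap_comp _ _)

/-- The presheaf `U ↦ Ω^τ_{O(U)/K}`. -/
noncomputable def omegaTauPre : (Opens X)ᵒᵖ ⥤ AddCommGrpCat.{u} where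
  obj U := .of (KSModule δ (Sec f U.unop))
  map i := AddCommGrpCat.ofHom (KSModule.map (res f i.unop.le))
  map_id U := by
    ext : 1
    exact (congrArg KSModule.map (res_self f _)).trans KSModule.map_id
  map_comp i j := by
    ext : 1
    exact (congrArg KSModule.map (res_comp f i.unop.le j.unop.le).symm).trans
      (KSModule.map_comp _ _)

/-- The presheaf map given by `λ` on each open set. -/
noncomputable def lambdaPre : omegaTauPre δ f ⟶ omegaPre f where
  app U := AddCommGrpCat.ofHom (KSModule.toKaehler δ (Sec f U.unop)).toAddMonoidHom
  naturality U V i := by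
    ext : 1
    exact KSModule.toKaehler_map δ (res f i.unop.le)

/-- The presheaf map given by `ι` on each open set. -/
noncomputable def iotaPre : structPre f ⟶ omegaTauPre δ f where
  app U := AddCommGrpCat.ofHom (KSModule.ofFun δ (Sec f U.unop))
  naturality U V i := by
    ext a
    exact (KSModule.map_smul_unit δ (res f i.unop.le) a).symm

lemma sec_ext {V : X.Opens} {a b : Sec f V}
    (H : ∀ x ∈ V, ∃ (W : X.Opens) (h : W ≤ V), x ∈ W ∧ res f h a = res f h b) : a = b := by
  choose W hW hx hab using H
  refine TopCat.Sheaf.eq_of_locally_eq' (X := X) ⟨structPre f, structPre_isSheaf f⟩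
    (fun x : V => W x.1 x.2) V (fun x => homOfLE (hW x.1 x.2)) ?_ a b (fun x => hab x.1 x.2)
  exact fun x hxV => Opens.mem_iSup.2 ⟨⟨x, hxV⟩, hx x hxV⟩

lemma sec_glue {V : X.Opens} {ι : Type u} (W : ι → X.Opens) (hW : ∀ i, W i ≤ V)
    (hcov : ∀ x ∈ V, ∃ i, x ∈ W i) (s : ∀ i, Sec f (W i))
    (hs : ∀ i j, res f (inf_le_left : W i ⊓ W j ≤ W i) (s i) =
      res f (inf_le_right : W i ⊓ W j ≤ W j) (s j)) :
    ∃ t : Sec f V, ∀ i, res f (hW i) t = s i := by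
  let s' : ∀ i, ToType ((structPre f).obj (op (W i))) := s
  have hs' : TopCat.Presheaf.IsCompatible (X := X) (structPre f) W s' := hs
  obtain ⟨t, ht, -⟩ := TopCat.Sheaf.existsUnique_gluing' (X := X)
    ⟨structPre f, structPre_isSheaf f⟩ W V (fun i => homOfLE (hW i))
    (fun x hx => Opens.mem_iSup.2 (hcov x hx)) s' hs'
  exact ⟨t, ht⟩

section Der

variable (R : Type*) [CommRing R] [∀ U : X.Opens, Algebra R (Sec f U)]

/-- The `R`-linear derivations of the sheaf of rings `O_X|_U`: families of `R`-linear derivations of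
the rings `O_X(V)`, `V ⊆ U` open, compatible with restriction. -/
def DerFam (U : X.Opens) :
    AddSubgroup (∀ V : {V : X.Opens // V ≤ U}, Derivation R (Sec f V.1) (Sec f V.1)) where
  carrier := {D | ∀ (V W : {V : X.Opens // V ≤ U}) (h : W.1 ≤ V.1) (a : Sec f V.1),
    res f h (D V a) = D W (res f h a)}
  zero_mem' _ _ _ _ := by simp
  add_mem' hD hE V W h a := by simp [hD V W h a, hE V W h a]
  neg_mem' hD V W h a := by simp [hD V W h a]

variable {R}

/-- Restriction of derivations to a smaller open set. -/
def DerFam.res {U V : X.Opens} (h : V ≤ U) : DerFam f R U →+ DerFam f R V where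
  toFun D := ⟨fun W => D.1 ⟨W.1, W.2.trans h⟩, fun W W' => D.2 ⟨W.1, W.2.trans h⟩ ⟨W'.1, W'.2.trans h⟩⟩
  map_zero' := rfl
  map_add' _ _ := rfl

lemma DerFam.exists_of_basis
    (hR : ∀ {U V : X.Opens} (h : V ≤ U) (r : R) (a : Sec f U),
      KSForms.res f h (r • a) = r • KSForms.res f h a)
    {U : X.Opens} (P : X.Opens → Prop)
    (hP : ∀ V ≤ U, ∀ x ∈ V, ∃ W ≤ V, x ∈ W ∧ P W)
    (D : ∀ V, P V → Derivation R (Sec f V) (Sec f V))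
    (hD : ∀ V W (hV : P V) (hW : P W) (h : W ≤ V) (a : Sec f V),
      KSForms.res f h (D V hV a) = D W hW (KSForms.res f h a)) :
    ∃ E : DerFam f R U, ∀ V (hV : P V) (h : V ≤ U), E.1 ⟨V, h⟩ = D V hV := by
  have key : ∀ V : {V : X.Opens // V ≤ U}, ∀ a : Sec f V.1, ∃ t : Sec f V.1,
      ∀ W (hW : P W) (h : W ≤ V.1), KSForms.res f h t = D W hW (KSForms.res f h a) := by
    intro V a
    obtain ⟨t, ht⟩ := sec_glue f (V := V.1) (ι := {W : X.Opens // P W ∧ W ≤ V.1}) (fun W => W.1)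
      (fun W => W.2.2) (fun x hx => by
        obtain ⟨W, hWV, hxW, hW⟩ := hP V.1 V.2 x hx
        exact ⟨⟨W, hW, hWV⟩, hxW⟩)
      (fun W => D W.1 W.2.1 (KSForms.res f W.2.2 a)) (fun i j => sec_ext f fun x hx => by
        obtain ⟨W, hWV, hxW, hW⟩ := hP _ (inf_le_left.trans (i.2.2.trans V.2)) x hx
        refine ⟨W, hWV, hxW, ?_⟩
        rw [res_res, res_res, hD _ W i.2.1 hW, hD _ W j.2.1 hW, res_res, res_res])
    exact ⟨t, fun W hW h => ht ⟨W, hW, h⟩⟩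
  choose E hE using key
  have ext : ∀ (V : {V : X.Opens // V ≤ U}) (a b : Sec f V.1),
      (∀ W (_ : P W) (h : W ≤ V.1), KSForms.res f h a = KSForms.res f h b) → a = b := by
    intro V a b H
    refine sec_ext f fun x hx => ?_
    obtain ⟨W, hWV, hxW, hW⟩ := hP V.1 V.2 x hx
    exact ⟨W, hWV, hxW, H W hW hWV⟩
  let E' : ∀ V : {V : X.Opens // V ≤ U}, Derivation R (Sec f V.1) (Sec f V.1) := fun V =>
    Derivation.mk'
      { toFun := E V
        map_add' := fun a b => ext V _ _ fun W hW h => by simp [hE _ _ W hW h]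
        map_smul' := fun r a => ext V _ _ fun W hW h => by simp [hE _ _ W hW h, hR] }
      (fun a b => ext V _ _ fun W hW h => by simp [hE _ _ W hW h])
  refine ⟨⟨E', fun V W h a => ext W _ _ fun W' hW' h' => ?_⟩, fun V hV h => ?_⟩
  · change KSForms.res f h' (KSForms.res f h (E V a)) = KSForms.res f h' (E W _)
    rw [res_res, hE V a W' hW' (h'.trans h), hE W _ W' hW' h', res_res]
  · ext a
    change E ⟨V, h⟩ a = _
    have := hE ⟨V, h⟩ a V hV le_rfl
    rwa [res_refl_apply, res_refl_apply] at this

lemma DerFam.ext_of_basis {U : X.Opens} (P : X.Opens → Prop)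
    (hP : ∀ V ≤ U, ∀ x ∈ V, ∃ W ≤ V, x ∈ W ∧ P W) {D E : DerFam f R U}
    (H : ∀ V (_ : P V) (h : V ≤ U), D.1 ⟨V, h⟩ = E.1 ⟨V, h⟩) : D = E := by
  refine Subtype.ext (funext fun V => Derivation.ext fun a => sec_ext f fun x hx => ?_)
  obtain ⟨W, hWV, hxW, hW⟩ := hP V.1 V.2 x hx
  refine ⟨W, hWV, hxW, ?_⟩
  rw [D.2 V ⟨W, hWV.trans V.2⟩ hWV, E.2 V ⟨W, hWV.trans V.2⟩ hWV, H W hW]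

variable (R) in
/-- The presheaf `U ↦ Der_R(O_X|_U)`. -/
noncomputable def derPre : (Opens X)ᵒᵖ ⥤ AddCommGrpCat.{u} where
  obj U := .of (DerFam f R U.unop)
  map i := AddCommGrpCat.ofHom (DerFam.res f i.unop.le)

lemma derPre_isSheaf (hR : ∀ {U V : X.Opens} (h : V ≤ U) (r : R) (a : Sec f U),
    KSForms.res f h (r • a) = r • KSForms.res f h a) :
    TopCat.Presheaf.IsSheaf (X := X) (derPre f R) := by
  rw [TopCat.Presheaf.isSheaf_iff_isSheafUniqueGluing]
  intro ι U s hs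
  let P : X.Opens → Prop := fun V => ∃ i, V ≤ U i
  have hP : ∀ V ≤ iSup U, ∀ x ∈ V, ∃ W ≤ V, x ∈ W ∧ P W := by
    intro V hV x hx
    obtain ⟨i, hi⟩ := Opens.mem_iSup.1 (hV hx)
    exact ⟨V ⊓ U i, inf_le_left, ⟨hx, hi⟩, i, inf_le_right⟩
  let s' : ∀ i, DerFam f R (U i) := s
  have hs' : ∀ i j V (hi : V ≤ U i) (hj : V ≤ U j), (s' i).1 ⟨V, hi⟩ = (s' j).1 ⟨V, hj⟩ := by
    intro i j V hi hj
    have : DerFam.res f inf_le_left (s' i) = DerFam.res f inf_le_right (s' j) := hs i j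
    exact congrFun (congrArg Subtype.val this) ⟨V, le_inf hi hj⟩
  obtain ⟨E, hE⟩ := DerFam.exists_of_basis f hR P hP
    (fun V hV => (s' hV.choose).1 ⟨V, hV.choose_spec⟩) (fun V W hV hW h a => by
      rw [hs' hW.choose hV.choose W hW.choose_spec (h.trans hV.choose_spec)]
      exact (s' hV.choose).2 ⟨V, _⟩ ⟨W, _⟩ h a)
  refine ⟨E, fun i => ?_, fun E' hE' => ?_⟩
  · refine Subtype.ext (funext fun V => ?_)
    have hV : P V.1 := ⟨i, V.2⟩
    exact (hE V.1 hV (V.2.trans (le_iSup U i))).trans (hs' _ _ _ _ _)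
  · refine DerFam.ext_of_basis f P hP (D := E') fun V hV h => ?_
    rw [hE V hV h]
    have : DerFam.res f (le_iSup U hV.choose) E' = s' hV.choose := hE' hV.choose
    rw [← this]
    rfl

end Der

section Prolongation

lemma formallySmooth_sec [Smooth f] {U : X.Opens} (hU : IsAffineOpen U) :
    Algebra.FormallySmooth K (Sec f U) := by
  have h : ((f.appLE ⊤ U le_top).hom.comp (Scheme.ΓSpecIso (.of K)).inv.hom).Smooth :=
    RingHom.Smooth.respectsIso.2 _ ((Scheme.ΓSpecIso (.of K)).symm.commRingCatIsoToRingEquiv)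
      (f.smooth_appLE (isAffineOpen_top _) hU le_top)
  have h' : Algebra.Smooth K (Sec f U) := h
  exact h'.formallySmooth

lemma exists_prolongation [Smooth f] {U : X.Opens} (hU : IsAffineOpen U) :
    ∃ D : DerFam f ℤ U, ∀ (V : {V : X.Opens // V ≤ U}) (c : K),
      D.1 V (algebraMap K _ c) = algebraMap K _ (δ c) := by
  have := formallySmooth_sec f hU
  obtain ⟨D₀, hD₀⟩ := exists_derivation_of_formallySmooth δ (Sec f U)
  let P : X.Opens → Prop := fun W => ∃ g : Γ(X, U), W = X.basicOpen g
  have hPU : ∀ W, P W → W ≤ U := by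
    rintro _ ⟨g, rfl⟩
    exact X.basicOpen_le g
  have hloc : ∀ W (hW : P W), letI := (res f (hPU W hW)).toRingHom.toAlgebra
      ∃ M : Submonoid (Sec f U), IsLocalization M (Sec f W) := by
    rintro _ ⟨g, rfl⟩
    exact ⟨_, hU.isLocalization_basicOpen g⟩
  have key : ∀ W (hW : P W), ∃ D : Derivation ℤ (Sec f W) (Sec f W),
      ∀ a, D (res f (hPU W hW) a) = res f (hPU W hW) (D₀ a) := by
    intro W hW
    let := (res f (hPU W hW)).toRingHom.toAlgebra
    obtain ⟨M, hM⟩ := hloc W hW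
    exact exists_derivation_of_isLocalization M D₀
  choose D hD using key
  obtain ⟨E, hE⟩ := DerFam.exists_of_basis f (fun h r a => map_zsmul (res f h) r a) P
    (fun V hV x hx => by
      obtain ⟨g, hg, hxg⟩ := hU.exists_basicOpen_le ⟨x, hx⟩ (hV hx)
      exact ⟨_, hg, hxg, g, rfl⟩) D (fun V W hV hW h a => by
      let := (res f (hPU V hV)).toRingHom.toAlgebra
      obtain ⟨M, hM⟩ := hloc V hV
      refine derivation_ext_of_isLocalization M (res f h).toRingHom (D V hV) (D W hW)
        (fun a => ?_) a
      change res f h (D V hV (res f (hPU V hV) a)) = D W hW (res f h (res f (hPU V hV) a))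
      rw [hD, res_res, res_res, hD])
  have hU' : P U := ⟨1, by simp⟩
  refine ⟨E, fun V c => ?_⟩
  have h1 := E.2 ⟨U, le_rfl⟩ V V.2 (algebraMap K _ c)
  rw [AlgHom.commutes] at h1
  rw [← h1, hE U hU']
  have h2 := hD U hU' (algebraMap K _ c)
  rw [AlgHom.commutes, hD₀, AlgHom.commutes] at h2
  rw [h2, AlgHom.commutes]

/-- The pairs `(g, D)` of a function `g` on `U` and a derivation `D` of the sheaf of rings `O_X|_U`
such that `D(c) = g · δ(c)` for `c ∈ K`. -/
def ProlPair (U : X.Opens) : AddSubgroup (Sec f U × DerFam f ℤ U) where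
  carrier := {p | ∀ (V : {V : X.Opens // V ≤ U}) (c : K),
    p.2.1 V (algebraMap K _ c) = res f V.2 p.1 * algebraMap K _ (δ c)}
  zero_mem' V c := by simp
  add_mem' hp hq V c := by simp [hp V c, hq V c, add_mul]
  neg_mem' hp V c := by simp [hp V c]

variable {δ f} in
lemma ProlPair.ext {U : X.Opens} {p q : ProlPair δ f U} (h₁ : p.1.1 = q.1.1)
    (h₂ : p.1.2 = q.1.2) : p = q :=
  Subtype.ext (Prod.ext h₁ h₂)

/-- Restriction of pairs to a smaller open set. -/
noncomputable def ProlPair.res {U V : X.Opens} (h : V ≤ U) : ProlPair δ f U →+ ProlPair δ f V where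
  toFun p := ⟨(KSForms.res f h p.1.1, DerFam.res f h p.1.2), fun W c => by
    exact (p.2 ⟨W.1, W.2.trans h⟩ c).trans (by rw [res_res])⟩
  map_zero' := by ext : 2 <;> simp
  map_add' _ _ := by ext : 2 <;> simp

lemma ProlPair.res_refl {U : X.Opens} (p : ProlPair δ f U) :
    ProlPair.res δ f le_rfl p = p :=
  ProlPair.ext (res_refl_apply f p.1.1) rfl

lemma ProlPair.res_res {U V W : X.Opens} (h : V ≤ U) (h' : W ≤ V) (p : ProlPair δ f U) :
    ProlPair.res δ f h' (ProlPair.res δ f h p) = ProlPair.res δ f (h'.trans h) p :=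
  ProlPair.ext (KSForms.res_res f h h' p.1.1) rfl

lemma mem_prolPair_of_local {ι : Type u} {U : ι → X.Opens} (g : Sec f (iSup U))
    (D : DerFam f ℤ (iSup U))
    (H : ∀ i, (KSForms.res f (le_iSup U i) g, DerFam.res f (le_iSup U i) D) ∈
      ProlPair δ f (U i)) : (g, D) ∈ ProlPair δ f (iSup U) := by
  refine fun V c => sec_ext f fun x hx => ?_
  obtain ⟨i, hi⟩ := Opens.mem_iSup.1 (V.2 hx)
  refine ⟨V.1 ⊓ U i, inf_le_left, ⟨hx, hi⟩, ?_⟩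
  have h1 := H i ⟨V.1 ⊓ U i, inf_le_right⟩ c
  have h2 := D.2 V ⟨V.1 ⊓ U i, inf_le_left.trans V.2⟩ inf_le_left (algebraMap K _ c)
  rw [AlgHom.commutes] at h2
  rw [map_mul, KSForms.res_res, AlgHom.commutes]
  refine h2.trans (h1.trans ?_)
  rw [KSForms.res_res]

/-- The presheaf of pairs `(g, D)` with `D|_K = g · δ`. -/
noncomputable def prolPre : (Opens X)ᵒᵖ ⥤ AddCommGrpCat.{u} where
  obj U := .of (ProlPair δ f U.unop)
  map i := AddCommGrpCat.ofHom (ProlPair.res δ f i.unop.le)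
  map_id U := by
    ext : 1
    exact AddMonoidHom.ext (ProlPair.res_refl δ f)
  map_comp i j := by
    ext : 1
    exact AddMonoidHom.ext fun p => (ProlPair.res_res δ f i.unop.le j.unop.le p).symm

lemma prolPre_isSheaf : TopCat.Presheaf.IsSheaf (X := X) (prolPre δ f) := by
  rw [TopCat.Presheaf.isSheaf_iff_isSheafUniqueGluing]
  intro ι U s hs
  let s' : ∀ i, ProlPair δ f (U i) := s
  have hs' : ∀ i j, ProlPair.res δ f (inf_le_left : U i ⊓ U j ≤ U i) (s' i) =
    ProlPair.res δ f (inf_le_right : U i ⊓ U j ≤ U j) (s' j) := hs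
  let s₁ : ∀ i, ToType ((structPre f).obj (op (U i))) := fun i => (s' i).1.1
  let s₂ : ∀ i, ToType ((derPre f ℤ).obj (op (U i))) := fun i => (s' i).1.2
  obtain ⟨g, hg, hg'⟩ := (TopCat.Presheaf.isSheaf_iff_isSheafUniqueGluing _).1
    (structPre_isSheaf f) U s₁ (fun i j => congrArg (fun p => p.1.1) (hs' i j))
  obtain ⟨D, hD, hD'⟩ := (TopCat.Presheaf.isSheaf_iff_isSheafUniqueGluing _).1
    (derPre_isSheaf f (R := ℤ) (fun h r a => map_zsmul (res f h) r a)) U s₂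
    (fun i j => congrArg (fun p => p.1.2) (hs' i j))
  have hg1 : ∀ i, res f (le_iSup U i) g = (s' i).1.1 := hg
  have hD1 : ∀ i, DerFam.res f (le_iSup U i) D = (s' i).1.2 := hD
  have hgD := mem_prolPair_of_local δ f g D fun i => by
    rw [hg1 i, hD1 i]
    exact (s' i).2
  refine ⟨⟨(g, D), hgD⟩, fun i => ProlPair.ext (hg i) (hD i),
    fun p hp => ProlPair.ext (hg' _ fun i => ?_) (hD' _ fun i => ?_)⟩
  · exact congrArg (fun p : ProlPair δ f (U i) => p.1.1) (hp i)
  · exact congrArg (fun p : ProlPair δ f (U i) => p.1.2) (hp i)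

end Prolongation

section Sheaves

/-- Sheaves of abelian groups on `X`. -/
abbrev AbSheaf (X : Scheme.{u}) := Sheaf (Opens.grothendieckTopology X) AddCommGrpCat.{u}

/-- The structure sheaf `O_X`. -/
noncomputable def structSheaf : AbSheaf X := ⟨structPre f, structPre_isSheaf f⟩

/-- The tangent sheaf `T_{X/K} = Der_K(O_X)`. -/
noncomputable def tangentSheaf : AbSheaf X :=
  ⟨derPre f K, derPre_isSheaf f (fun h r a => _root_.map_smul (res f h) r a)⟩

/-- The sheaf `𝒟` of pairs `(g, D)` with `g` a function and `D` a derivation with `D|_K = g · δ`. -/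
noncomputable def prolSheaf : AbSheaf X := ⟨prolPre δ f, prolPre_isSheaf δ f⟩

/-- The sheaf `Ω_{X/K}` of differentials, associated to `U ↦ Ω_{O(U)/K}`. -/
noncomputable def omegaSheaf : AbSheaf X :=
  (presheafToSheaf (Opens.grothendieckTopology X) AddCommGrpCat.{u}).obj (omegaPre f)

/-- The sheaf `Ω^τ_{X/K}` of KS-forms, associated to `U ↦ Ω^τ_{O(U)/K}`. -/
noncomputable def omegaTauSheaf : AbSheaf X :=
  (presheafToSheaf (Opens.grothendieckTopology X) AddCommGrpCat.{u}).obj (omegaTauPre δ f)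

/-- The map `ι : O_X → Ω^τ_{X/K}`, `g ↦ g • 1`. -/
noncomputable def iota : structSheaf f ⟶ omegaTauSheaf δ f :=
  ⟨iotaPre δ f ≫ toSheafify (Opens.grothendieckTopology X) (omegaTauPre δ f)⟩

/-- The map `λ : Ω^τ_{X/K} → Ω_{X/K}`, `1 ↦ 0`, `d^τ a ↦ da`. -/
noncomputable def lambda : omegaTauSheaf δ f ⟶ omegaSheaf f :=
  (presheafToSheaf (Opens.grothendieckTopology X) AddCommGrpCat.{u}).map (lambdaPre δ f)

lemma iotaPre_lambdaPre : iotaPre δ f ≫ lambdaPre δ f = 0 := by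
  ext U a
  exact KSModule.toKaehler_ofFun δ (Sec f U.unop) a

lemma iota_lambda : iota δ f ≫ lambda δ f = 0 := by
  apply Sheaf.hom_ext
  change (iotaPre δ f ≫ toSheafify _ (omegaTauPre δ f)) ≫
    sheafifyMap (Opens.grothendieckTopology X) (lambdaPre δ f) = 0
  rw [Category.assoc, ← toSheafify_naturality, ← Category.assoc, iotaPre_lambdaPre]
  simp

/-- The sequence `O_X → Ω^τ_{X/K} → Ω_{X/K}`. -/
noncomputable def ksFormSeq : ShortComplex (AbSheaf X) :=
  ShortComplex.mk (iota δ f) (lambda δ f) (iota_lambda δ f)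

/-- The inclusion `D ↦ (0, D)`. -/
noncomputable def DerFam.toProlPair (U : X.Opens) : DerFam f K U →+ ProlPair δ f U where
  toFun D := ⟨(0, ⟨fun V => (D.1 V).restrictScalars ℤ, D.2⟩), fun V c => by
    simp⟩
  map_zero' := by ext : 2 <;> rfl
  map_add' D E := by
    refine ProlPair.ext ?_ rfl
    simp

/-- The inclusion `T_{X/K} → 𝒟`, `D ↦ (0, D)`. -/
noncomputable def tangentToProl : tangentSheaf f ⟶ prolSheaf δ f where
  hom :=
    { app U := AddCommGrpCat.ofHom (DerFam.toProlPair δ f U.unop)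
      naturality U V i := by
        ext : 1
        exact AddMonoidHom.ext fun D => ProlPair.ext (map_zero (res f i.unop.le)).symm rfl }

/-- The projection `𝒟 → O_X`, `(g, D) ↦ g`. -/
noncomputable def prolToStruct : prolSheaf δ f ⟶ structSheaf f where
  hom :=
    { app U := AddCommGrpCat.ofHom
        ((AddMonoidHom.fst _ _).comp (ProlPair δ f U.unop).subtype)
      naturality _ _ _ := rfl }

lemma tangentToProl_prolToStruct : tangentToProl δ f ≫ prolToStruct δ f = 0 := by
  apply Sheaf.hom_ext
  ext U D
  rfl

/-- The sequence `T_{X/K} → 𝒟 → O_X`. -/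
noncomputable def prolSeq : ShortComplex (AbSheaf X) :=
  ShortComplex.mk (tangentToProl δ f) (prolToStruct δ f) (tangentToProl_prolToStruct δ f)

/-- A pair `(0, D)` is the same as a `K`-linear derivation. -/
noncomputable def DerFam.ofProlPair {U : X.Opens} (p : ProlPair δ f U) (hp : p.1.1 = 0) :
    DerFam f K U :=
  ⟨fun V => Derivation.mk'
    { toFun := p.1.2.1 V
      map_add' := map_add _
      map_smul' := fun c a => by
        have h := p.2 V c
        rw [hp, map_zero, zero_mul] at h
        rw [Algebra.smul_def, Derivation.leibniz, h, smul_zero, add_zero, RingHom.id_apply,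
          Algebra.smul_def c, smul_eq_mul] }
    (fun a b => (p.1.2.1 V).leibniz a b), p.1.2.2⟩

lemma DerFam.toProlPair_injective (U : X.Opens) :
    Function.Injective (DerFam.toProlPair δ f U) := fun _ _ h =>
  Subtype.ext (funext fun V => Derivation.ext fun a =>
    congrArg (fun p : ProlPair δ f U => p.1.2.1 V a) h)

instance : Mono (tangentToProl δ f) := by
  have : ∀ U : (Opens X)ᵒᵖ, Function.Injective ((tangentToProl δ f).hom.app U) := fun U =>
    DerFam.toProlPair_injective δ f U.unop
  exact Sheaf.mono_of_injective _ this

lemma DerFam.toProlPair_ofProlPair {U : X.Opens} (p : ProlPair δ f U) (hp : p.1.1 = 0) :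
    DerFam.toProlPair δ f U (DerFam.ofProlPair δ f p hp) = p :=
  ProlPair.ext hp.symm rfl

/-- Homomorphisms into the kernel of `(g, D) ↦ g` factor through the `K`-linear derivations. -/
noncomputable def DerFam.liftHom {G : Type*} [AddCommGroup G] {U : X.Opens}
    (φ : G →+ ProlPair δ f U) (hφ : ∀ g, (φ g).1.1 = 0) : G →+ DerFam f K U where
  toFun g := DerFam.ofProlPair δ f (φ g) (hφ g)
  map_zero' := Subtype.ext <| funext fun V => Derivation.ext fun a =>
    congrArg (fun p : ProlPair δ f U => p.1.2.1 V a) (map_zero φ)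
  map_add' g h := Subtype.ext <| funext fun V => Derivation.ext fun a =>
    congrArg (fun p : ProlPair δ f U => p.1.2.1 V a) (map_add φ g h)

lemma prolSeq_exact : (prolSeq δ f).Exact := by
  have : Mono (prolSeq δ f).f := inferInstanceAs (Mono (tangentToProl δ f))
  refine ShortComplex.exact_of_f_is_kernel _ (Limits.KernelFork.IsLimit.ofι' _ _
    fun {W} k hk => ?_)
  let φ (U : (Opens X)ᵒᵖ) : W.obj.obj U →+ ProlPair δ f U.unop := (k.hom.app U).hom
  have hφ : ∀ U w, (φ U w).1.1 = 0 := fun U w =>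
    DFunLike.congr_fun (congrArg (fun φ => (φ.hom.app U).hom) hk) w
  refine ⟨⟨{
    app U := AddCommGrpCat.ofHom (DerFam.liftHom δ f (φ U) (hφ U))
    naturality U V i := ?_ }⟩, ?_⟩
  · ext w
    refine DerFam.toProlPair_injective δ f V.unop ?_
    refine (DerFam.toProlPair_ofProlPair δ f _ (hφ V _)).trans ?_
    refine (ConcreteCategory.congr_hom (k.hom.naturality i) w).trans ?_
    exact (congrArg (ProlPair.res δ f i.unop.le)
      (DerFam.toProlPair_ofProlPair δ f _ (hφ U w)).symm).trans
        (ProlPair.ext (map_zero _) rfl)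
  · apply Sheaf.hom_ext
    ext U w
    exact DerFam.toProlPair_ofProlPair δ f _ (hφ U w)

lemma prolToStruct_locally_surjective [Smooth f] {V : X.Opens} (g : Sec f V) (x : X)
    (hx : x ∈ V) : ∃ (W : X.Opens) (h : W ≤ V) (_ : x ∈ W) (p : ProlPair δ f W),
      p.1.1 = res f h g := by
  obtain ⟨U, hU, hxU, hUV⟩ := (Opens.isBasis_iff_nbhd.1 X.isBasis_affineOpens) hx
  obtain ⟨D, hD⟩ := exists_prolongation δ f hU
  refine ⟨U, hUV, hxU, ⟨(res f hUV g, ⟨fun V => res f V.2 (res f hUV g) • D.1 V,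
    fun V W h a => ?_⟩), fun V c => ?_⟩, rfl⟩
  · rw [Derivation.smul_apply, Derivation.smul_apply, smul_eq_mul, smul_eq_mul, map_mul,
      res_res, D.2 V W h a]
  · change res f V.2 (res f hUV g) • D.1 V (algebraMap K _ c) = _
    rw [hD, smul_eq_mul]

instance [Smooth f] : Epi (prolToStruct δ f) := by
  refine (TopCat.Sheaf.isLocallySurjective_iff_epi (X := X) (prolToStruct δ f)).1 ?_
  rw [TopCat.Presheaf.isLocallySurjective_iff]
  intro V g x hx
  obtain ⟨W, h, hxW, p, hp⟩ := prolToStruct_locally_surjective δ f (V := V) g x hx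
  exact ⟨W, h, ⟨p, hp⟩, hxW⟩

lemma prolSeq_shortExact [Smooth f] : (prolSeq δ f).ShortExact where
  exact := prolSeq_exact δ f
  mono_f := inferInstanceAs (Mono (tangentToProl δ f))
  epi_g := inferInstanceAs (Epi (prolToStruct δ f))

/-- The connecting map `Γ(X, S₃) → H¹(X, S₁)` of a short exact sequence
`0 → S₁ → S₂ → S₃ → 0` of abelian sheaves on `X`. -/
noncomputable def connecting {S : ShortComplex (AbSheaf X)} (hS : S.ShortExact)
    (s : S.X₃.obj.obj (op ⊤)) : S.X₁.H 1 :=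
  ((Sheaf.H.equiv₀ S.X₃ Limits.isTerminalTop).symm s).comp hS.extClass (zero_add 1)

/-- The Kodaira-Spencer class `KS_X(δ) ∈ H¹(X, T_{X/K})`: the image of `1` under the connecting map
of `0 → T_{X/K} → 𝒟 → O_X → 0`. The sections of `𝒟` over `1 ∈ O(U)` are exactly the derivations
`δ_U` of the ring sheaf `O_X|_U` extending `δ`, so for a cover `(U_i)` with such extensions `δ_i`
this is the class of the cocycle `(δ_i - δ_j)`. -/
noncomputable def kodairaSpencer [Smooth f] : (tangentSheaf f).H 1 :=
  connecting (prolSeq_shortExact δ f) (1 : Sec f ⊤)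

/-- The presheaf `V ↦ O_X(U ∩ V)`, the extension to `X` of `O_X|_U`. -/
noncomputable def pushPre (U : X.Opens) : (Opens X)ᵒᵖ ⥤ AddCommGrpCat.{u} where
  obj V := .of (Sec f (U ⊓ V.unop))
  map i := AddCommGrpCat.ofHom (res f (inf_le_inf_left U i.unop.le)).toAddMonoidHom
  map_id V := by
    ext a
    exact res_refl_apply f a
  map_comp i j := by
    ext a
    exact (res_res f _ _ a).symm

lemma pushPre_isSheaf (U : X.Opens) : TopCat.Presheaf.IsSheaf (X := X) (pushPre f U) := by
  rw [TopCat.Presheaf.isSheaf_iff_isSheafUniqueGluing]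
  intro ι V s hs
  let s' : ∀ i, Sec f (U ⊓ V i) := s
  have hs' : ∀ i j, res f (inf_le_inf_left U (inf_le_left : V i ⊓ V j ≤ V i)) (s' i) =
    res f (inf_le_inf_left U (inf_le_right : V i ⊓ V j ≤ V j)) (s' j) := hs
  have hle : ∀ i, U ⊓ V i ≤ U ⊓ iSup V := fun i => inf_le_inf_left U (le_iSup V i)
  have hcov : ∀ x ∈ U ⊓ iSup V, ∃ i, x ∈ U ⊓ V i := fun x hx => by
    obtain ⟨i, hi⟩ := Opens.mem_iSup.1 hx.2
    exact ⟨i, hx.1, hi⟩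
  obtain ⟨t, ht⟩ := sec_glue f (V := U ⊓ iSup V) (fun i => U ⊓ V i) hle hcov s' (fun i j => by
    have h := congrArg (res f (show (U ⊓ V i) ⊓ (U ⊓ V j) ≤ U ⊓ (V i ⊓ V j) from
      le_inf (inf_le_left.trans inf_le_left) (inf_le_inf inf_le_right inf_le_right))) (hs' i j)
    rwa [res_res, res_res] at h)
  refine ⟨t, ht, fun t' ht' => sec_ext f fun x hx => ?_⟩
  obtain ⟨i, hi⟩ := hcov x hx
  exact ⟨_, hle i, hi, (ht' i).trans (ht i).symm⟩

variable {f}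

/-- The map `Ω_{O(V)/K} → O(U ∩ V)`, `a db ↦ a t(b)`, for a `K`-linear derivation `t` over `U`. -/
noncomputable def contractFun {U : X.Opens} (t : DerFam f K U) (V : X.Opens) :
    Ω[Sec f V⁄K] →+ Sec f (U ⊓ V) :=
  (t.1 ⟨U ⊓ V, inf_le_left⟩).liftKaehlerDifferential.toAddMonoidHom.comp
    (kaehlerMap (res f inf_le_right))

lemma contractFun_smul_D {U : X.Opens} (t : DerFam f K U) (V : X.Opens) (a b : Sec f V) :
    contractFun t V (a • KaehlerDifferential.D K _ b) =
      res f inf_le_right a * t.1 ⟨U ⊓ V, inf_le_left⟩ (res f inf_le_right b) := by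
  change (t.1 ⟨U ⊓ V, inf_le_left⟩).liftKaehlerDifferential
    (kaehlerMap (res f inf_le_right) (a • KaehlerDifferential.D K _ b)) = _
  rw [kaehlerMap_smul, kaehlerMap_D, map_smul, Derivation.liftKaehlerDifferential_comp_D,
    smul_eq_mul]

lemma contractFun_res {U : X.Opens} (t : DerFam f K U) {V W : X.Opens} (h : W ≤ V) :
    (contractFun t W).comp (kaehlerMap (res f h)) =
      (res f (inf_le_inf_left U h)).toAddMonoidHom.comp (contractFun t V) :=
  kaehler_addHom_ext fun a b => by
    change contractFun t W (kaehlerMap (res f h) (a • KaehlerDifferential.D K _ b)) =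
      res f (inf_le_inf_left U h) (contractFun t V (a • KaehlerDifferential.D K _ b))
    have h' := t.2 ⟨U ⊓ V, inf_le_left⟩ ⟨U ⊓ W, inf_le_left⟩
      (inf_le_inf_left U h) (res f inf_le_right b)
    rw [kaehlerMap_smul, kaehlerMap_D, contractFun_smul_D, contractFun_smul_D, map_mul, h']
    simp only [res_res]

/-- Contraction with a `K`-linear derivation `t` over `U`, as a presheaf map with components
`Ω_{O(V)/K} → O(U ∩ V)`, `a db ↦ a t(b)`. -/
noncomputable def contractPre {U : X.Opens} (t : DerFam f K U) : omegaPre f ⟶ pushPre f U where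
  app V := AddCommGrpCat.ofHom (contractFun t V.unop)
  naturality V W i := by
    ext : 1
    exact contractFun_res t i.unop.le

/-- The same contraction on the associated sheaf `Ω_{X/K}`. -/
noncomputable def contractHom {U : X.Opens} (t : DerFam f K U) :
    sheafify (Opens.grothendieckTopology X) (omegaPre f) ⟶ pushPre f U :=
  sheafifyLift (Opens.grothendieckTopology X) (contractPre t) (pushPre_isSheaf f U)

lemma toSheafify_contractHom {U : X.Opens} (t : DerFam f K U) :
    toSheafify (Opens.grothendieckTopology X) (omegaPre f) ≫ contractHom t = contractPre t :=
  toSheafify_sheafifyLift _ _ _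

variable (f) in
/-- The group `Γ(U, Ω_{X/K})` of differential forms on `U`. -/
abbrev Omega (U : X.Opens) : Type u := (omegaSheaf f).obj.obj (op U)

variable (f) in
/-- Restriction of differential forms to a smaller open set. -/
noncomputable def resOmega {U V : X.Opens} (h : V ≤ U) : Omega f U →+ Omega f V :=
  ((omegaSheaf f).obj.map (homOfLE h).op).hom

/-- The contraction with `t`, on sections of the sheaf `Ω_{X/K}` over `V`. -/
noncomputable def contractApp {U : X.Opens} (t : DerFam f K U) (V : X.Opens) :
    Omega f V →+ Sec f (U ⊓ V) :=
  ((contractHom t).app (op V)).hom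

/-- The contraction `⟨t, ω⟩ ∈ O_X(U)` of a vector field `t` and a differential form `ω` on `U`. -/
noncomputable def contract {U : X.Opens} (t : DerFam f K U) (ω : Omega f U) : Sec f U :=
  res f (le_inf le_rfl le_rfl) (contractApp t U ω)

lemma contractHom_add {U : X.Opens} (t t' : DerFam f K U) :
    contractHom (t + t') = contractHom t + contractHom t' := by
  refine sheafify_hom_ext _ _ _ (pushPre_isSheaf f U) ?_
  rw [Preadditive.comp_add, toSheafify_contractHom, toSheafify_contractHom,
    toSheafify_contractHom]
  ext V : 3
  refine kaehler_addHom_ext fun a b => ?_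
  refine (contractFun_smul_D (t + t') V.unop a b).trans (Eq.symm ?_)
  refine (congrArg₂ (· + ·) (contractFun_smul_D t V.unop a b)
    (contractFun_smul_D t' V.unop a b)).trans ?_
  exact (mul_add _ _ _).symm

variable (f) in
/-- Restriction from `U` to `U'`. -/
noncomputable def pushRes {U U' : X.Opens} (h : U' ≤ U) : pushPre f U ⟶ pushPre f U' where
  app V := AddCommGrpCat.ofHom (res f (inf_le_inf_right V.unop h)).toAddMonoidHom
  naturality V W i := by
    ext a
    exact (res_res f _ _ a).trans (res_res f _ _ a).symm

lemma contractFun_pushRes {U U' : X.Opens} (h : U' ≤ U) (t : DerFam f K U) (V : X.Opens) :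
    contractFun (DerFam.res f h t) V =
      (res f (inf_le_inf_right V h)).toAddMonoidHom.comp (contractFun t V) :=
  kaehler_addHom_ext fun a b => by
    change _ = res f (inf_le_inf_right V h) (contractFun t V (a • KaehlerDifferential.D K _ b))
    have h' := t.2 ⟨U ⊓ V, inf_le_left⟩ ⟨U' ⊓ V, inf_le_left.trans h⟩
      (inf_le_inf_right V h) (res f inf_le_right b)
    rw [contractFun_smul_D, contractFun_smul_D, map_mul, h', res_res, res_res]
    rfl

lemma contractHom_res {U U' : X.Opens} (h : U' ≤ U) (t : DerFam f K U) :
    contractHom (DerFam.res f h t) = contractHom t ≫ pushRes f h := by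
  refine sheafify_hom_ext _ _ _ (pushPre_isSheaf f U') ?_
  rw [← Category.assoc, toSheafify_contractHom, toSheafify_contractHom]
  ext V : 3
  exact contractFun_pushRes h t V.unop

lemma contractApp_res {U U' : X.Opens} (h : U' ≤ U) (t : DerFam f K U) (V : X.Opens)
    (ω : Omega f V) : contractApp (DerFam.res f h t) V ω =
      res f (inf_le_inf_right V h) (contractApp t V ω) :=
  ConcreteCategory.congr_hom (NatTrans.congr_app (contractHom_res h t) (op V)) ω

lemma contractApp_resOmega {U V W : X.Opens} (h : W ≤ V) (t : DerFam f K U) (ω : Omega f V) :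
    contractApp t W (resOmega f h ω) = res f (inf_le_inf_left U h) (contractApp t V ω) :=
  ConcreteCategory.congr_hom ((contractHom t).naturality (homOfLE h).op) ω

lemma res_contract {U V : X.Opens} (h : V ≤ U) (t : DerFam f K U) (ω : Omega f U) :
    res f h (contract t ω) = contract (DerFam.res f h t) (resOmega f h ω) := by
  rw [contract, contract, contractApp_res, contractApp_resOmega]
  simp only [res_res]

lemma contract_add {U : X.Opens} (t t' : DerFam f K U) (ω : Omega f U) :
    contract (t + t') ω = contract t ω + contract t' ω := by
  have h : contractApp (t + t') U ω = contractApp t U ω + contractApp t' U ω :=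
    ConcreteCategory.congr_hom (NatTrans.congr_app (contractHom_add t t') (op U)) ω
  rw [contract, h, map_add, contract, contract]

variable (f) in
/-- The section of the sheaf `Ω_{X/K}` given by an element of `Ω_{O(U)/K}`. -/
noncomputable def omegaOf (U : X.Opens) : Ω[Sec f U⁄K] →+ Omega f U :=
  ((toSheafify (Opens.grothendieckTopology X) (omegaPre f)).app (op U)).hom

/-- On the differentials of functions the contraction is `⟨t, a db⟩ = a t(b)`. -/
lemma contract_omegaOf {U : X.Opens} (t : DerFam f K U) (w : Ω[Sec f U⁄K]) :
    contract t (omegaOf f U w) = (t.1 ⟨U, le_rfl⟩).liftKaehlerDifferential w := by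
  have h : contractApp t U (omegaOf f U w) = contractFun t U w :=
    ConcreteCategory.congr_hom (NatTrans.congr_app (toSheafify_sheafifyLift
      (Opens.grothendieckTopology X) (contractPre t) (pushPre_isSheaf f U)) (op U)) w
  rw [contract, h]
  refine DFunLike.congr_fun (f := (res f _).toAddMonoidHom.comp (contractFun t U))
    (g := (t.1 ⟨U, le_rfl⟩).liftKaehlerDifferential.toAddMonoidHom)
    (kaehler_addHom_ext fun a b => ?_) w
  change res f _ (contractFun t U (a • KaehlerDifferential.D K _ b)) =
    (t.1 ⟨U, le_rfl⟩).liftKaehlerDifferential (a • KaehlerDifferential.D K _ b)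
  have h' := t.2 ⟨U ⊓ U, inf_le_left⟩ ⟨U, le_rfl⟩ (le_inf le_rfl le_rfl) (res f inf_le_right b)
  rw [contractFun_smul_D, map_smul, Derivation.liftKaehlerDifferential_comp_D, map_mul, h',
    res_res, res_res, res_refl_apply, res_refl_apply, smul_eq_mul]

/-- The contraction `⟨·, ω⟩ : T_{X/K} → O_X` with a global differential form `ω`. -/
noncomputable def contractWith (ω : Omega f ⊤) : tangentSheaf f ⟶ structSheaf f where
  hom :=
    { app U := AddCommGrpCat.ofHom (AddMonoidHom.mk' (fun t : DerFam f K U.unop =>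
        contract t (resOmega f le_top ω)) (fun t t' => contract_add t t' _))
      naturality U V i := by
        ext t
        refine Eq.trans ?_ (res_contract i.unop.le t (resOmega f le_top ω)).symm
        refine congrArg (contract (DerFam.res f i.unop.le t)) ?_
        exact ConcreteCategory.congr_hom
          ((omegaSheaf f).obj.map_comp (homOfLE le_top).op (homOfLE i.unop.le).op) ω }

/-- The cup product `H¹(X, T_{X/K}) × H⁰(X, Ω_{X/K}) → H¹(X, T_{X/K} ⊗ Ω_{X/K}) → H¹(X, O_X)`,
where the second map is contraction. The cup product with a class `ω` of degree `0` is the map on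
`H¹` induced by the map of sheaves `⟨·, ω⟩`. -/
noncomputable def cup (κ : (tangentSheaf f).H 1) (ω : Omega f ⊤) : (structSheaf f).H 1 :=
  Sheaf.H.map (contractWith ω) 1 κ

variable (f) in
/-- The group `Γ(U, Ω^τ_{X/K})` of KS-forms on `U`. -/
abbrev OmegaTau (U : X.Opens) : Type u := (omegaTauSheaf δ f).obj.obj (op U)

variable (f) in
/-- Restriction of KS-forms to a smaller open set. -/
noncomputable def resOmegaTau {U V : X.Opens} (h : V ≤ U) : OmegaTau δ f U →+ OmegaTau δ f V :=
  ((omegaTauSheaf δ f).obj.map (homOfLE h).op).hom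

variable (f) in
/-- The section of the sheaf `Ω^τ_{X/K}` given by an element of `Ω^τ_{O(U)/K}`. -/
noncomputable def omegaTauOf (U : X.Opens) : KSModule δ (Sec f U) →+ OmegaTau δ f U :=
  ((toSheafify (Opens.grothendieckTopology X) (omegaTauPre δ f)).app (op U)).hom

variable (f) in
/-- The map `ι : O_X → Ω^τ_{X/K}` on sections over `U`. -/
noncomputable def iotaApp (U : X.Opens) : Sec f U →+ OmegaTau δ f U :=
  ((iota δ f).hom.app (op U)).hom

variable (f) in
/-- The map `λ : Ω^τ_{X/K} → Ω_{X/K}` on sections over `U`. -/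
noncomputable def lambdaApp (U : X.Opens) : OmegaTau δ f U →+ Omega f U :=
  ((lambda δ f).hom.app (op U)).hom

end Sheaves
end Scheme
end KSForms

/-! A pair `(g, D)` with `D(c) = g δ(c)` on constants gives an additive map `Ω → Ω^τ`, `a db ↦ a (g
d^τ b - D(b) · 1)`: the factor in brackets obeys the Leibniz rule in `b`, and it kills constants
because `g d^τ c = g δ(c) · 1 = D(c) · 1`. For `g = 1` this is a splitting of `λ`; for a `K`-linear
`t`, the pair `(0, t)` gives `ω ↦ -⟨t, ω⟩ · 1`.

With `ω` fixed and the pair varying, this becomes a morphism from `0 → T → 𝒟 → O → 0` to `0 → O →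
Ω^τ → Ω → 0` (`prolSeqToKsFormSeq`), equal to minus the contraction with `ω` on the left and to `g ↦
g ω` on the right. The right-hand map sends `1` to `ω`, so naturality of the connecting map
(`connecting_naturality`) yields `c(ω) = -KS ⌣ ω` without choosing a cover. The long exact sequence
(`connecting_eq_zero_iff`) turns this into the lifting criterion.

Exactness of the second sequence is mostly algebra: for every `K`-algebra `λ` is surjective and its
kernel is generated by the form `1` (`KSModule.exists_eq_ofFun`). Injectivity of `ι` needs a
derivation `D` extending `δ`, which provides the retraction `1 ↦ 1`, `d^τ a ↦ D(a)`; on affine opens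
smoothness supplies such a `D` (`exists_prolongation`).

For a cover, `σ_i` is the map of the pair `(1, δ_i)`, and `(1, δ_i) = (0, t_ij) + (1, δ_j)` on
overlaps computes `σ_i - σ_j`. A global lift of `ω` is the same as a family `σ_i(ω) + ι(g_i)`
agreeing on overlaps, that is, `⟨t_ij, ω⟩ = g_i - g_j`. -/

namespace KSForms

/-! ### KS-forms of a `K`-algebra: the maps given by pairs `(g, D)`, and exactness of `A → Ω^τ → Ω →
0`. -/

section TwistedSplitting

variable {K : Type u} [CommRing K] {δ : Derivation ℤ K K} {A : Type u} [CommRing A] [Algebra K A]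

/-- The universal property of `Ω_{A/K}` for `A`-modules without a given `K`-module structure. -/
lemma exists_kaehler_lift {M : Type u} [AddCommGroup M] [Module A M] (d : A →+ M)
    (d_mul : ∀ a b, d (a * b) = a • d b + b • d a)
    (d_const : ∀ c : K, d (algebraMap K A c) = 0) :
    ∃ φ : Ω[A⁄K] →ₗ[A] M, ∀ b, φ (KaehlerDifferential.D K A b) = d b := by
  -- Let `K` act on `M` through `A`; a derivation that vanishes on constants is then exactly a
  -- `K`-linear one.
  let : Module K M := Module.compHom M (algebraMap K A)
  have : IsScalarTower K A M := ⟨fun c a m => by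
    rw [Algebra.smul_def, mul_smul]; rfl⟩
  let D : Derivation K A M := Derivation.mk'
    { toFun := d
      map_add' := map_add d
      map_smul' := fun c a => by
        rw [Algebra.smul_def, d_mul, d_const, smul_zero, add_zero]; rfl } d_mul
  exact ⟨D.liftKaehlerDifferential, D.liftKaehlerDifferential_comp_D⟩

/-- The Leibniz rule is inherited from `d^τ` and `D`. On constants both terms equal `g δ(c) · 1`,
which is what the condition on the pair `(g, D)` says. -/
lemma exists_twist (g : A) (D : Derivation ℤ A A)
    (hD : ∀ c : K, D (algebraMap K A c) = g * algebraMap K A (δ c)) :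
    ∃ φ : Ω[A⁄K] →ₗ[A] KSModule δ A, ∀ b, φ (KaehlerDifferential.D K A b) =
      g • KSModule.dτ δ b - D b • KSModule.unit δ A := by
  refine exists_kaehler_lift (AddMonoidHom.mk' (fun b => g • KSModule.dτ δ b -
    D b • KSModule.unit δ A) fun a b => ?_) (fun a b => ?_) fun c => ?_
  · rw [KSModule.dτ_add, map_add]
    module
  · simp only [AddMonoidHom.mk'_apply]
    rw [KSModule.dτ_mul, D.leibniz, smul_eq_mul, smul_eq_mul]
    module
  · simp only [AddMonoidHom.mk'_apply]
    rw [KSModule.dτ_const, hD, mul_smul, sub_self]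

/-- The map `Ω_{A/K} → Ω^τ_{A/K}`, `a db ↦ a (g d^τ b - D(b) · 1)`, given by a function `g` and a
derivation `D` of `A` such that `D(c) = g δ(c)` on constants. -/
noncomputable def twist (g : A) (D : Derivation ℤ A A)
    (hD : ∀ c : K, D (algebraMap K A c) = g * algebraMap K A (δ c)) :
    Ω[A⁄K] →ₗ[A] KSModule δ A :=
  (exists_twist g D hD).choose

lemma twist_smul_D (g : A) (D : Derivation ℤ A A)
    (hD : ∀ c : K, D (algebraMap K A c) = g * algebraMap K A (δ c)) (a b : A) :
    twist g D hD (a • KaehlerDifferential.D K A b) =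
      a • (g • KSModule.dτ δ b - D b • KSModule.unit δ A) := by
  rw [LinearMap.map_smul, twist, (exists_twist g D hD).choose_spec]

lemma KSModule.toKaehler_smul_dτ (a b : A) :
    KSModule.toKaehler δ A (a • KSModule.dτ δ b) = a • KaehlerDifferential.D K A b := by
  rw [_root_.map_smul, KSModule.toKaehler, KSModule.lift_dτ]

lemma KSModule.toKaehler_smul_unit (a : A) :
    KSModule.toKaehler δ A (a • KSModule.unit δ A) = 0 :=
  KSModule.toKaehler_ofFun δ A a

lemma KSModule.toKaehler_surjective : Function.Surjective (KSModule.toKaehler δ A) := by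
  rw [← LinearMap.range_eq_top, eq_top_iff, ← KaehlerDifferential.span_range_derivation,
    Submodule.span_le]
  rintro _ ⟨b, rfl⟩
  exact ⟨KSModule.dτ δ b, by rw [← one_smul A (KSModule.dτ δ b), toKaehler_smul_dτ, one_smul]⟩

/-- The kernel of `λ` is generated by the form `1`. -/
lemma KSModule.exists_eq_ofFun {x : KSModule δ A} (hx : KSModule.toKaehler δ A x = 0) :
    ∃ a, KSModule.ofFun δ A a = x := by
  -- Modulo the form `1`, `d^τ` becomes a derivation that vanishes on constants. The quotient map
  -- therefore factors through `λ`, and whatever `λ` kills lies in `N`.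
  let N : Submodule A (KSModule δ A) := Submodule.span A {KSModule.unit δ A}
  have hN : ∀ a : A, N.mkQ (a • KSModule.unit δ A) = 0 := fun a => by
    rw [Submodule.mkQ_apply, Submodule.Quotient.mk_eq_zero]
    exact N.smul_mem a (Submodule.mem_span_singleton_self _)
  obtain ⟨φ, hφ⟩ := exists_kaehler_lift (K := K)
    (AddMonoidHom.mk' (fun b => N.mkQ (KSModule.dτ δ b)) fun a b => by
      rw [KSModule.dτ_add, map_add]) (fun a b => by
      simp only [AddMonoidHom.mk'_apply]
      rw [KSModule.dτ_mul, map_add, _root_.map_smul, _root_.map_smul]) fun c => by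
      simp only [AddMonoidHom.mk'_apply]
      rw [KSModule.dτ_const, hN]
  have key : (φ ∘ₗ KSModule.toKaehler δ A).toAddMonoidHom = N.mkQ.toAddMonoidHom := by
    refine KSModule.addHom_ext (fun a => ?_) fun a b => ?_
    · change φ (KSModule.toKaehler δ A _) = N.mkQ _
      rw [toKaehler_smul_unit, map_zero, hN]
    · change φ (KSModule.toKaehler δ A _) = N.mkQ _
      rw [toKaehler_smul_dτ, _root_.map_smul, _root_.map_smul, hφ]
      rfl
  have h : φ (KSModule.toKaehler δ A x) = N.mkQ x := DFunLike.congr_fun key x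
  rw [hx, map_zero, eq_comm, Submodule.mkQ_apply, Submodule.Quotient.mk_eq_zero] at h
  exact Submodule.mem_span_singleton.1 h

/-- The universal property applied to `D` gives an `A`-linear retraction of `ι`, with `1 ↦ 1` and
`d^τ b ↦ D(b)`; the relation `d^τ c = δ(c) · 1` is respected because `D` extends `δ`. -/
lemma KSModule.ofFun_injective (D : Derivation ℤ A A)
    (hD : ∀ c : K, D (algebraMap K A c) = algebraMap K A (δ c)) :
    Function.Injective (KSModule.ofFun δ A) := by
  refine (injective_iff_map_eq_zero _).2 fun a ha => ?_
  have h : KSModule.lift (1 : A) D (map_add D) D.leibniz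
      (fun c => (hD c).trans (mul_one _).symm) (a • KSModule.unit δ A) = 0 :=
    (congrArg _ ha).trans (map_zero _)
  rwa [_root_.map_smul, KSModule.lift_unit, smul_eq_mul, mul_one] at h

end TwistedSplitting

/-! ### Sections of abelian sheaves and of associated sheaves. -/

section Sections

variable {X : Scheme.{u}}

/-- Restriction of sections of an abelian sheaf. -/
noncomputable def restrict (F : AbSheaf X) {U V : X.Opens} (h : V ≤ U) :
    F.obj.obj (op U) →+ F.obj.obj (op V) :=
  (F.obj.map (homOfLE h).op).hom

lemma restrict_restrict (F : AbSheaf X) {U V W : X.Opens} (h : V ≤ U) (h' : W ≤ V)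
    (s : F.obj.obj (op U)) : restrict F h' (restrict F h s) = restrict F (h'.trans h) s :=
  (ConcreteCategory.congr_hom (F.obj.map_comp (homOfLE h).op (homOfLE h').op) s).symm

lemma restrict_self (F : AbSheaf X) {U : X.Opens} (s : F.obj.obj (op U)) :
    restrict F le_rfl s = s :=
  ConcreteCategory.congr_hom (F.obj.map_id (op U)) s

lemma section_ext (F : AbSheaf X) {V : X.Opens} {a b : F.obj.obj (op V)}
    (H : ∀ x ∈ V, ∃ (W : X.Opens) (h : W ≤ V), x ∈ W ∧ restrict F h a = restrict F h b) :
    a = b := by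
  choose W hW hx hab using H
  refine TopCat.Sheaf.eq_of_locally_eq' (X := X) F
    (fun x : V => W x.1 x.2) V (fun x => homOfLE (hW x.1 x.2)) ?_ a b (fun x => hab x.1 x.2)
  exact fun x hxV => Opens.mem_iSup.2 ⟨⟨x, hxV⟩, hx x hxV⟩

lemma section_glue (F : AbSheaf X) {V : X.Opens} {ι : Type u} (W : ι → X.Opens)
    (hW : ∀ i, W i ≤ V) (hcov : ∀ x ∈ V, ∃ i, x ∈ W i) (s : ∀ i, F.obj.obj (op (W i)))
    (hs : ∀ i j, restrict F (inf_le_left : W i ⊓ W j ≤ W i) (s i) =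
      restrict F (inf_le_right : W i ⊓ W j ≤ W j) (s j)) :
    ∃ t : F.obj.obj (op V), ∀ i, restrict F (hW i) t = s i := by
  obtain ⟨t, ht, -⟩ := TopCat.Sheaf.existsUnique_gluing' (X := X) F W V
    (fun i => homOfLE (hW i)) (fun x hx => Opens.mem_iSup.2 (hcov x hx)) s hs
  exact ⟨t, ht⟩

lemma restrict_hom {F G : AbSheaf X} (φ : F ⟶ G) {U V : X.Opens} (h : V ≤ U)
    (s : F.obj.obj (op U)) :
    restrict G h ((φ.hom.app (op U)).hom s) = (φ.hom.app (op V)).hom (restrict F h s) :=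
  (ConcreteCategory.congr_hom (φ.hom.naturality (homOfLE h).op) s).symm

/-- The presheaf `V ↦ F(U ∩ V)`. -/
noncomputable def extendPre (F : AbSheaf X) (U : X.Opens) : (Opens X)ᵒᵖ ⥤ AddCommGrpCat.{u} where
  obj V := F.obj.obj (op (U ⊓ V.unop))
  map i := AddCommGrpCat.ofHom (restrict F (inf_le_inf_left U i.unop.le))
  map_id V := by
    ext a
    exact restrict_self F a
  map_comp i j := by
    ext a
    exact (restrict_restrict F _ _ a).symm

/-- This is the direct image on `X` of the restriction of `F` to `U`. As a sheaf on all of `X` it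
can be the target of a map out of a sheafification, which is how maps defined only over `U` are
constructed. -/
lemma extendPre_isSheaf (F : AbSheaf X) (U : X.Opens) :
    TopCat.Presheaf.IsSheaf (X := X) (extendPre F U) := by
  rw [TopCat.Presheaf.isSheaf_iff_isSheafUniqueGluing]
  intro ι V s hs
  let s' : ∀ i, F.obj.obj (op (U ⊓ V i)) := s
  have hs' : ∀ i j, restrict F (inf_le_inf_left U (inf_le_left : V i ⊓ V j ≤ V i)) (s' i) =
    restrict F (inf_le_inf_left U (inf_le_right : V i ⊓ V j ≤ V j)) (s' j) := hs
  have hle : ∀ i, U ⊓ V i ≤ U ⊓ iSup V := fun i => inf_le_inf_left U (le_iSup V i)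
  have hcov : ∀ x ∈ U ⊓ iSup V, ∃ i, x ∈ U ⊓ V i := fun x hx => by
    obtain ⟨i, hi⟩ := Opens.mem_iSup.1 hx.2
    exact ⟨i, hx.1, hi⟩
  obtain ⟨t, ht⟩ := section_glue F (V := U ⊓ iSup V) (fun i => U ⊓ V i) hle hcov s'
    (fun i j => by
      -- The two ways of intersecting give equal but not syntactically equal open sets, so the
      -- compatibility is transported by a restriction.
      have h := congrArg (restrict F (show (U ⊓ V i) ⊓ (U ⊓ V j) ≤ U ⊓ (V i ⊓ V j) from
        le_inf (inf_le_left.trans inf_le_left) (inf_le_inf inf_le_right inf_le_right))) (hs' i j)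
      rwa [restrict_restrict, restrict_restrict] at h)
  refine ⟨t, ht, fun t' ht' => section_ext F fun x hx => ?_⟩
  obtain ⟨i, hi⟩ := hcov x hx
  exact ⟨_, hle i, hi, (ht' i).trans (ht i).symm⟩

lemma exists_toSheafify_eq (P : (Opens X)ᵒᵖ ⥤ AddCommGrpCat.{u}) {V : X.Opens}
    (s : ((presheafToSheaf (Opens.grothendieckTopology X) AddCommGrpCat.{u}).obj P).obj.obj (op V))
    (x : X) (hx : x ∈ V) :
    ∃ (W : X.Opens) (h : W ≤ V) (_ : x ∈ W) (w : P.obj (op W)),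
      ((toSheafify (Opens.grothendieckTopology X) P).app (op W)).hom w = restrict _ h s := by
  obtain ⟨W, h, ⟨w, hw⟩, hxW⟩ := (TopCat.Presheaf.isLocallySurjective_iff (X := X)
    (toSheafify (Opens.grothendieckTopology X) P)).1
    (Presheaf.isLocallySurjective_toSheafify' (J := Opens.grothendieckTopology X) P) V s x hx
  exact ⟨W, h, hxW, w, hw⟩

lemma exists_map_eq_of_toSheafify_eq (P : (Opens X)ᵒᵖ ⥤ AddCommGrpCat.{u}) {V : X.Opens}
    {v w : P.obj (op V)}
    (hvw : ((toSheafify (Opens.grothendieckTopology X) P).app (op V)).hom v =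
      ((toSheafify (Opens.grothendieckTopology X) P).app (op V)).hom w) (x : X) (hx : x ∈ V) :
    ∃ (W : X.Opens) (h : W ≤ V), x ∈ W ∧
      (P.map (homOfLE h).op).hom v = (P.map (homOfLE h).op).hom w := by
  obtain ⟨W, i, hi, hxW⟩ := (Presheaf.isLocallyInjective_toSheafify'
    (J := Opens.grothendieckTopology X) P).equalizerSieve_mem v w hvw x hx
  exact ⟨W, i.le, hxW, hi⟩

end Sections

/-! ### Naturality and kernel of the connecting map. -/

section Connecting

variable {X : Scheme.{u}}

/-- The connecting map is the Yoneda product with the extension class, and a morphism of short exact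
sequences identifies the pushforward of one class along `τ₁` with the pullback of the other along
`τ₃`. -/
lemma connecting_naturality {S S' : ShortComplex (AbSheaf X)} (hS : S.ShortExact)
    (hS' : S'.ShortExact) (φ : S ⟶ S') (s : S.X₃.obj.obj (op ⊤)) :
    connecting hS' ((φ.τ₃.hom.app (op ⊤)).hom s) = Sheaf.H.map φ.τ₁ 1 (connecting hS s) := by
  have h := Sheaf.H.equiv₀_symm_naturality Limits.isTerminalTop φ.τ₃ s
  rw [connecting, connecting, Sheaf.H.map_apply]
  erw [← h]
  rw [Sheaf.H.map_apply, Abelian.Ext.comp_assoc_of_second_deg_zero,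
    Abelian.Ext.comp_assoc_of_third_deg_zero,
    ShortComplex.ShortExact.extClass_naturality hS hS' φ]

/-- Exactness of the long Ext sequence at `H⁰` of the third term, with `H⁰` identified with global
sections by `Sheaf.H.equiv₀`. -/
lemma connecting_eq_zero_iff {S : ShortComplex (AbSheaf X)} (hS : S.ShortExact)
    (s : S.X₃.obj.obj (op ⊤)) :
    connecting hS s = 0 ↔ ∃ t : S.X₂.obj.obj (op ⊤), (S.g.hom.app (op ⊤)).hom t = s := by
  constructor
  · intro h
    obtain ⟨y, hy⟩ := Abelian.Ext.covariant_sequence_exact₃ _ hS _ (zero_add 1) h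
    refine ⟨Sheaf.H.equiv₀ S.X₂ Limits.isTerminalTop y,
      (Sheaf.H.equiv₀_naturality Limits.isTerminalTop S.g y).trans ?_⟩
    rw [Sheaf.H.map_apply, hy, AddEquiv.apply_symm_apply]
  · rintro ⟨t, rfl⟩
    have h := Sheaf.H.equiv₀_symm_naturality Limits.isTerminalTop S.g t
    rw [connecting]
    erw [← h]
    rw [Sheaf.H.map_apply, Abelian.Ext.comp_assoc_of_second_deg_zero,
      ShortComplex.ShortExact.comp_extClass, Abelian.Ext.comp_zero]

end Connecting

/-! ### Maps out of the sheaf `Ω_{X/K}` over an open set. -/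

section Extension

variable {K : Type u} [CommRing K] {X : Scheme.{u}} {f : X ⟶ Spec (.of K)}

lemma resOmega_omegaOf {U V : X.Opens} (h : V ≤ U) (w : Ω[Sec f U⁄K]) :
    resOmega f h (omegaOf f U w) = omegaOf f V (kaehlerMap (res f h) w) :=
  (ConcreteCategory.congr_hom ((toSheafify (Opens.grothendieckTopology X)
    (omegaPre f)).naturality (homOfLE h).op) w).symm

lemma resOmega_resOmega {U V W : X.Opens} (h : V ≤ U) (h' : W ≤ V) (w : Omega f U) :
    resOmega f h' (resOmega f h w) = resOmega f (h'.trans h) w :=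
  restrict_restrict (omegaSheaf f) h h' w

lemma resOmega_self {U : X.Opens} (w : Omega f U) : resOmega f le_rfl w = w :=
  restrict_self (omegaSheaf f) w

/-- Natural additive maps on the sections of `Ω_{X/K}` agree if they agree on the forms `a db`. -/
lemma omega_hom_ext (F : AbSheaf X) {U : X.Opens}
    {Φ Ψ : ∀ V : {V : X.Opens // V ≤ U}, Omega f V.1 →+ F.obj.obj (op V.1)}
    (hΦ : ∀ (V W : {V : X.Opens // V ≤ U}) (h : W.1 ≤ V.1) (w : Omega f V.1),
      restrict F h (Φ V w) = Φ W (resOmega f h w))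
    (hΨ : ∀ (V W : {V : X.Opens // V ≤ U}) (h : W.1 ≤ V.1) (w : Omega f V.1),
      restrict F h (Ψ V w) = Ψ W (resOmega f h w))
    (H : ∀ (V : {V : X.Opens // V ≤ U}) (a b : Sec f V.1),
      Φ V (omegaOf f V.1 (a • KaehlerDifferential.D K _ b)) =
        Ψ V (omegaOf f V.1 (a • KaehlerDifferential.D K _ b))) : Φ = Ψ := by
  funext V
  ext w
  refine section_ext F fun x hx => ?_
  -- Locally a section of `Ω_{X/K}` comes from `Ω_{O(W)/K}`, which is additively generated by the
  -- forms `a db`.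
  obtain ⟨W, h, hxW, v, hv⟩ := exists_toSheafify_eq (omegaPre f) w x hx
  refine ⟨W, h, hxW, ?_⟩
  rw [hΦ V ⟨W, h.trans V.2⟩ h, hΨ V ⟨W, h.trans V.2⟩ h]
  have hv' : omegaOf f W v = resOmega f h w := hv
  rw [← hv']
  exact DFunLike.congr_fun (kaehler_addHom_ext (f := (Φ ⟨W, h.trans V.2⟩).comp (omegaOf f W))
    (g := (Ψ ⟨W, h.trans V.2⟩).comp (omegaOf f W)) (H ⟨W, h.trans V.2⟩)) v

/-- Natural additive maps on the modules `Ω_{O(V)/K}` extend to the sections of `Ω_{X/K}`. -/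
lemma exists_omega_extension (F : AbSheaf X) {U : X.Opens}
    (φ : ∀ V : {V : X.Opens // V ≤ U}, Ω[Sec f V.1⁄K] →+ F.obj.obj (op V.1))
    (hφ : ∀ (V W : {V : X.Opens // V ≤ U}) (h : W.1 ≤ V.1) (w : Ω[Sec f V.1⁄K]),
      restrict F h (φ V w) = φ W (kaehlerMap (res f h) w)) :
    ∃ Φ : ∀ V : {V : X.Opens // V ≤ U}, Omega f V.1 →+ F.obj.obj (op V.1),
      (∀ (V W : {V : X.Opens // V ≤ U}) (h : W.1 ≤ V.1) (w : Omega f V.1),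
        restrict F h (Φ V w) = Φ W (resOmega f h w)) ∧
      ∀ (V : {V : X.Opens // V ≤ U}) (w : Ω[Sec f V.1⁄K]), Φ V (omegaOf f V.1 w) = φ V w := by
  let ψ (V : X.Opens) : Ω[Sec f V⁄K] →+ F.obj.obj (op (U ⊓ V)) :=
    (φ ⟨U ⊓ V, inf_le_left⟩).comp (kaehlerMap (res f inf_le_right))
  let φ' : omegaPre f ⟶ extendPre F U :=
    { app V := AddCommGrpCat.ofHom (ψ V.unop)
      naturality V W i := by
        ext w
        refine Eq.trans ?_ (hφ ⟨U ⊓ V.unop, inf_le_left⟩ ⟨U ⊓ W.unop, inf_le_left⟩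
          (inf_le_inf_left U i.unop.le) (kaehlerMap (res f inf_le_right) w)).symm
        refine congrArg (φ ⟨U ⊓ W.unop, inf_le_left⟩) ?_
        change ((kaehlerMap _).comp (kaehlerMap _)) w = ((kaehlerMap _).comp (kaehlerMap _)) w
        rw [← kaehlerMap_comp, ← kaehlerMap_comp, res_comp, res_comp] }
  let Φ := sheafifyLift (Opens.grothendieckTopology X) φ' (extendPre_isSheaf F U)
  have hΦ : toSheafify (Opens.grothendieckTopology X) (omegaPre f) ≫ Φ = φ' :=
    toSheafify_sheafifyLift _ _ _
  -- `Φ` takes values in `F(U ∩ V)`; for `V ≤ U`, restriction along `V ≤ U ∩ V` moves them to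
  -- `F(V)`.
  refine ⟨fun V => (restrict F (le_inf V.2 le_rfl)).comp (Φ.app (op V.1)).hom, ?_, ?_⟩
  · intro V W h w
    have h1 : restrict F (inf_le_inf_left U h) ((Φ.app (op V.1)).hom w) =
        (Φ.app (op W.1)).hom (resOmega f h w) :=
      (ConcreteCategory.congr_hom (Φ.naturality (homOfLE h).op) w).symm
    change restrict F h (restrict F _ ((Φ.app (op V.1)).hom w)) =
      restrict F _ ((Φ.app (op W.1)).hom (resOmega f h w))
    rw [← h1]
    exact (restrict_restrict F _ _ _).trans (restrict_restrict F _ _ _).symm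
  · intro V w
    have h1 : (Φ.app (op V.1)).hom (omegaOf f V.1 w) = ψ V.1 w :=
      ConcreteCategory.congr_hom (NatTrans.congr_app hΦ (op V.1)) w
    change restrict F _ ((Φ.app (op V.1)).hom (omegaOf f V.1 w)) = φ V w
    rw [h1]
    refine (hφ ⟨U ⊓ V.1, inf_le_left⟩ V (le_inf V.2 le_rfl) _).trans (congrArg (φ V) ?_)
    change ((kaehlerMap _).comp (kaehlerMap _)) w = w
    rw [← kaehlerMap_comp, res_comp, res_self, kaehlerMap_id]
    rfl

end Extension

/-! ### Multiplication by functions, and the maps `Ω_{X/K} → Ω^τ_{X/K}` given by pairs. -/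

section Forms

variable {K : Type u} [CommRing K] {X : Scheme.{u}} {f : X ⟶ Spec (.of K)}

/-- `omegaSheaf` carries only its structure of abelian sheaf, so multiplication by `g` is extended
from the modules `Ω_{O(V)/K}`. It is needed to form the map `g ↦ g ω` between the right-hand ends of
the two sequences. -/
lemma exists_omegaSmul {U : X.Opens} (g : Sec f U) :
    ∃ Φ : ∀ V : {V : X.Opens // V ≤ U}, Omega f V.1 →+ Omega f V.1,
      (∀ (V W : {V : X.Opens // V ≤ U}) (h : W.1 ≤ V.1) (w : Omega f V.1),
        resOmega f h (Φ V w) = Φ W (resOmega f h w)) ∧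
      ∀ (V : {V : X.Opens // V ≤ U}) (w : Ω[Sec f V.1⁄K]),
        Φ V (omegaOf f V.1 w) = omegaOf f V.1 (res f V.2 g • w) := by
  refine exists_omega_extension (omegaSheaf f) (fun V => (omegaOf f V.1).comp
    (DistribSMul.toAddMonoidHom _ (res f V.2 g))) fun V W h w => ?_
  refine (resOmega_omegaOf h (res f V.2 g • w)).trans (congrArg (omegaOf f W.1) ?_)
  rw [kaehlerMap_smul, res_res]
  rfl

/-- Multiplication of differential forms by a function `g` on `U`. -/
noncomputable def omegaSmul {U : X.Opens} (g : Sec f U) (V : {V : X.Opens // V ≤ U}) :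
    Omega f V.1 →+ Omega f V.1 :=
  (exists_omegaSmul g).choose V

lemma resOmega_omegaSmul {U : X.Opens} (g : Sec f U) (V W : {V : X.Opens // V ≤ U})
    (h : W.1 ≤ V.1) (w : Omega f V.1) :
    resOmega f h (omegaSmul g V w) = omegaSmul g W (resOmega f h w) :=
  (exists_omegaSmul g).choose_spec.1 V W h w

lemma omegaSmul_omegaOf {U : X.Opens} (g : Sec f U) (V : {V : X.Opens // V ≤ U})
    (w : Ω[Sec f V.1⁄K]) : omegaSmul g V (omegaOf f V.1 w) = omegaOf f V.1 (res f V.2 g • w) :=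
  (exists_omegaSmul g).choose_spec.2 V w

lemma omegaSmul_add {U : X.Opens} (g g' : Sec f U) (V : {V : X.Opens // V ≤ U})
    (w : Omega f V.1) : omegaSmul (g + g') V w = omegaSmul g V w + omegaSmul g' V w := by
  refine DFunLike.congr_fun (congrFun (omega_hom_ext (omegaSheaf f) (Φ := omegaSmul (g + g'))
    (Ψ := fun V => omegaSmul g V + omegaSmul g' V) (resOmega_omegaSmul _)
    (fun V W h w => ?_) fun V a b => ?_) V) w
  · exact (map_add (resOmega f h) _ _).trans
      (congrArg₂ (· + ·) (resOmega_omegaSmul g V W h w) (resOmega_omegaSmul g' V W h w))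
  · rw [AddMonoidHom.add_apply, omegaSmul_omegaOf, omegaSmul_omegaOf, omegaSmul_omegaOf,
      map_add, add_smul, map_add]

lemma omegaSmul_one {U : X.Opens} (V : {V : X.Opens // V ≤ U}) (w : Omega f V.1) :
    omegaSmul (1 : Sec f U) V w = w := by
  refine DFunLike.congr_fun (congrFun (omega_hom_ext (omegaSheaf f) (Φ := omegaSmul (1 : Sec f U))
    (Ψ := fun V => AddMonoidHom.id _) (resOmega_omegaSmul _)
    (fun V W h w => rfl) fun V a b => ?_) V) w
  rw [omegaSmul_omegaOf, map_one, one_smul, AddMonoidHom.id_apply]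

lemma omegaSmul_res {U U' : X.Opens} (h : U' ≤ U) (g : Sec f U) (V : {V : X.Opens // V ≤ U'})
    (w : Omega f V.1) : omegaSmul (res f h g) V w = omegaSmul g ⟨V.1, V.2.trans h⟩ w := by
  refine DFunLike.congr_fun (congrFun (omega_hom_ext (omegaSheaf f) (Φ := omegaSmul (res f h g))
    (Ψ := fun V => omegaSmul g ⟨V.1, V.2.trans h⟩) (resOmega_omegaSmul _)
    (fun V W h' w => resOmega_omegaSmul g ⟨V.1, V.2.trans h⟩ ⟨W.1, W.2.trans h⟩ h' w) fun V a b => ?_) V) w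
  rw [omegaSmul_omegaOf, omegaSmul_omegaOf g ⟨V.1, V.2.trans h⟩, res_res]

variable {δ : Derivation ℤ K K}

lemma resOmegaTau_omegaTauOf {U V : X.Opens} (h : V ≤ U) (w : KSModule δ (Sec f U)) :
    resOmegaTau δ f h (omegaTauOf δ f U w) = omegaTauOf δ f V (KSModule.map (res f h) w) :=
  (ConcreteCategory.congr_hom ((toSheafify (Opens.grothendieckTopology X)
    (omegaTauPre δ f)).naturality (homOfLE h).op) w).symm

lemma resOmegaTau_resOmegaTau {U V W : X.Opens} (h : V ≤ U) (h' : W ≤ V) (w : OmegaTau δ f U) :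
    resOmegaTau δ f h' (resOmegaTau δ f h w) = resOmegaTau δ f (h'.trans h) w :=
  restrict_restrict (omegaTauSheaf δ f) h h' w

lemma lambdaApp_omegaTauOf (U : X.Opens) (w : KSModule δ (Sec f U)) :
    lambdaApp δ f U (omegaTauOf δ f U w) = omegaOf f U (KSModule.toKaehler δ _ w) :=
  (ConcreteCategory.congr_hom (NatTrans.congr_app (toSheafify_naturality
    (Opens.grothendieckTopology X) (lambdaPre δ f)) (op U)) w).symm

lemma iotaApp_eq (U : X.Opens) (a : Sec f U) :
    iotaApp δ f U a = omegaTauOf δ f U (KSModule.ofFun δ _ a) :=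
  rfl

lemma resOmegaTau_iotaApp {U V : X.Opens} (h : V ≤ U) (a : Sec f U) :
    resOmegaTau δ f h (iotaApp δ f U a) = iotaApp δ f V (res f h a) :=
  restrict_hom (iota δ f) h a

lemma resOmega_lambdaApp {U V : X.Opens} (h : V ≤ U) (w : OmegaTau δ f U) :
    resOmega f h (lambdaApp δ f U w) = lambdaApp δ f V (resOmegaTau δ f h w) :=
  restrict_hom (lambda δ f) h w

lemma lambdaApp_iotaApp (U : X.Opens) (a : Sec f U) :
    lambdaApp δ f U (iotaApp δ f U a) = 0 :=
  DFunLike.congr_fun (congrArg (fun φ => (φ.hom.app (op U)).hom) (iota_lambda δ f)) a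

lemma map_twist {U V : X.Opens} (h : V ≤ U) {g : Sec f U} {D : Derivation ℤ (Sec f U) (Sec f U)}
    (hD : ∀ c : K, D (algebraMap K _ c) = g * algebraMap K _ (δ c))
    {g' : Sec f V} {D' : Derivation ℤ (Sec f V) (Sec f V)}
    (hD' : ∀ c : K, D' (algebraMap K _ c) = g' * algebraMap K _ (δ c))
    (hg : res f h g = g') (hDD' : ∀ a, res f h (D a) = D' (res f h a)) (w : Ω[Sec f U⁄K]) :
    KSModule.map (res f h) (twist g D hD w) = twist g' D' hD' (kaehlerMap (res f h) w) := by
  refine DFunLike.congr_fun (f := (KSModule.map (res f h)).comp (twist g D hD).toAddMonoidHom)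
    (g := (twist g' D' hD').toAddMonoidHom.comp (kaehlerMap (res f h)))
    (kaehler_addHom_ext fun a b => ?_) w
  change KSModule.map (res f h) (twist g D hD (a • KaehlerDifferential.D K _ b)) =
    twist g' D' hD' (kaehlerMap (res f h) (a • KaehlerDifferential.D K _ b))
  rw [kaehlerMap_smul, kaehlerMap_D, twist_smul_D, twist_smul_D, KSModule.map_smul, map_sub,
    KSModule.map_smul, KSModule.map_smul, KSModule.map_dτ, KSModule.map_unit, hg, hDD']

/-- All pairs `(g, D)` are admitted, not only those with `g = 1`, so that the result is additive in
the pair and a fixed form yields a sheaf map on `𝒟`. The maps `twist` commute with restriction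
because `D` does. -/
lemma exists_splitting {U : X.Opens} (p : ProlPair δ f U) :
    ∃ Φ : ∀ V : {V : X.Opens // V ≤ U}, Omega f V.1 →+ OmegaTau δ f V.1,
      (∀ (V W : {V : X.Opens // V ≤ U}) (h : W.1 ≤ V.1) (w : Omega f V.1),
        resOmegaTau δ f h (Φ V w) = Φ W (resOmega f h w)) ∧
      ∀ (V : {V : X.Opens // V ≤ U}) (w : Ω[Sec f V.1⁄K]), Φ V (omegaOf f V.1 w) =
        omegaTauOf δ f V.1 (twist (res f V.2 p.1.1) (p.1.2.1 V) (p.2 V) w) := by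
  refine exists_omega_extension (omegaTauSheaf δ f) (fun V => (omegaTauOf δ f V.1).comp
    (twist (res f V.2 p.1.1) (p.1.2.1 V) (p.2 V)).toAddMonoidHom) fun V W h w => ?_
  refine (resOmegaTau_omegaTauOf h _).trans (congrArg (omegaTauOf δ f W.1) ?_)
  exact map_twist h _ _ (res_res f _ _ _) (p.1.2.2 V W h) w

/-- The map `Ω_{X/K} → Ω^τ_{X/K}`, `a db ↦ a (g d^τ b - D(b) · 1)`, over `U` given by a pair `(g, D)`
over `U`. For `g = 1` it splits `λ`. -/
noncomputable def splitting {U : X.Opens} (p : ProlPair δ f U) (V : {V : X.Opens // V ≤ U}) :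
    Omega f V.1 →+ OmegaTau δ f V.1 :=
  (exists_splitting p).choose V

lemma resOmegaTau_splitting {U : X.Opens} (p : ProlPair δ f U) (V W : {V : X.Opens // V ≤ U})
    (h : W.1 ≤ V.1) (w : Omega f V.1) :
    resOmegaTau δ f h (splitting p V w) = splitting p W (resOmega f h w) :=
  (exists_splitting p).choose_spec.1 V W h w

lemma splitting_smul_D {U : X.Opens} (p : ProlPair δ f U) (V : {V : X.Opens // V ≤ U})
    (a b : Sec f V.1) : splitting p V (omegaOf f V.1 (a • KaehlerDifferential.D K _ b)) =
      omegaTauOf δ f V.1 (a • (res f V.2 p.1.1 • KSModule.dτ δ b -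
        p.1.2.1 V b • KSModule.unit δ _)) :=
  ((exists_splitting p).choose_spec.2 V _).trans (congrArg _ (twist_smul_D _ _ _ a b))

lemma splitting_add {U : X.Opens} (p q : ProlPair δ f U) (V : {V : X.Opens // V ≤ U})
    (w : Omega f V.1) : splitting (p + q) V w = splitting p V w + splitting q V w := by
  refine DFunLike.congr_fun (congrFun (omega_hom_ext (omegaTauSheaf δ f) (Φ := splitting (p + q))
    (Ψ := fun V => splitting p V + splitting q V) (resOmegaTau_splitting _)
    (fun V W h w => ?_) fun V a b => ?_) V) w
  · exact (map_add (resOmegaTau δ f h) _ _).trans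
      (congrArg₂ (· + ·) (resOmegaTau_splitting p V W h w) (resOmegaTau_splitting q V W h w))
  · rw [AddMonoidHom.add_apply, splitting_smul_D, splitting_smul_D, splitting_smul_D, ← map_add]
    congr 1
    have h1 : (p + q).1.1 = p.1.1 + q.1.1 := rfl
    have h2 : (p + q).1.2.1 V b = p.1.2.1 V b + q.1.2.1 V b := rfl
    rw [h1, h2, map_add]
    module

lemma splitting_res {U U' : X.Opens} (h : U' ≤ U) (p : ProlPair δ f U)
    (V : {V : X.Opens // V ≤ U'}) (w : Omega f V.1) :
    splitting (ProlPair.res δ f h p) V w = splitting p ⟨V.1, V.2.trans h⟩ w := by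
  refine DFunLike.congr_fun (congrFun (omega_hom_ext (omegaTauSheaf δ f)
    (Φ := splitting (ProlPair.res δ f h p))
    (Ψ := fun V => splitting p ⟨V.1, V.2.trans h⟩) (resOmegaTau_splitting _)
    (fun V W h' w => resOmegaTau_splitting p ⟨V.1, V.2.trans h⟩ ⟨W.1, W.2.trans h⟩ h' w) fun V a b => ?_) V) w
  rw [splitting_smul_D, splitting_smul_D p ⟨V.1, V.2.trans h⟩, ← res_res f h V.2]
  rfl

/-- `λ` kills the term `D(b) · 1`, and only `a g db` remains. -/
lemma lambdaApp_splitting {U : X.Opens} (p : ProlPair δ f U) (V : {V : X.Opens // V ≤ U})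
    (w : Omega f V.1) : lambdaApp δ f V.1 (splitting p V w) = omegaSmul p.1.1 V w := by
  refine DFunLike.congr_fun (congrFun (omega_hom_ext (omegaSheaf f)
    (Φ := fun V => (lambdaApp δ f V.1).comp (splitting p V))
    (Ψ := omegaSmul p.1.1) (fun V W h w => ?_) (resOmega_omegaSmul _) fun V a b => ?_) V) w
  · exact (resOmega_lambdaApp h _).trans (congrArg _ (resOmegaTau_splitting p V W h w))
  · rw [AddMonoidHom.comp_apply, splitting_smul_D, lambdaApp_omegaTauOf, omegaSmul_omegaOf,
      smul_sub, map_sub, smul_smul, smul_smul, KSModule.toKaehler_smul_dτ,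
      KSModule.toKaehler_smul_unit, sub_zero, mul_comm, mul_smul]

/-- With `g = 0` only `-a t(b) · 1` survives on `a db`. This is the source of the minus sign in the
theorem. -/
lemma splitting_toProlPair {U : X.Opens} (t : DerFam f K U) (V : {V : X.Opens // V ≤ U})
    (w : Omega f V.1) : splitting (DerFam.toProlPair δ f U t) V w =
      -iotaApp δ f V.1 (contract (DerFam.res f V.2 t) w) := by
  -- The right-hand side is packaged as a family of additive maps so that `omega_hom_ext` applies.
  let Ψ (V : {V : X.Opens // V ≤ U}) : Omega f V.1 →+ OmegaTau δ f V.1 :=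
    -(iotaApp δ f V.1).comp (AddMonoidHom.mk' (contract (DerFam.res f V.2 t))
      fun w w' => by rw [contract, contract, contract, map_add, map_add])
  have hΨ (V : {V : X.Opens // V ≤ U}) (w : Omega f V.1) :
    Ψ V w = -iotaApp δ f V.1 (contract (DerFam.res f V.2 t) w) := rfl
  refine DFunLike.congr_fun (congrFun (omega_hom_ext (omegaTauSheaf δ f)
    (Φ := splitting (DerFam.toProlPair δ f U t)) (Ψ := Ψ)
    (resOmegaTau_splitting _) (fun V W h w => ?_) fun V a b => ?_) V) w
  · rw [hΨ, hΨ]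
    refine (map_neg (resOmegaTau δ f h) _).trans (congrArg Neg.neg ?_)
    refine (resOmegaTau_iotaApp h _).trans (congrArg (iotaApp δ f W.1) ?_)
    exact res_contract h (DerFam.res f V.2 t) w
  · rw [splitting_smul_D, hΨ]
    rw [contract_omegaOf, iotaApp_eq, ← map_neg,
      LinearMap.map_smul (Derivation.liftKaehlerDifferential _), Derivation.liftKaehlerDifferential_comp_D]
    congr 1
    have h1 : (DerFam.toProlPair δ f U t).1.1 = 0 := rfl
    have h2 : (DerFam.toProlPair δ f U t).1.2.1 V b = t.1 V b := rfl
    have h3 : (DerFam.res f V.2 t).1 ⟨V.1, le_rfl⟩ b = t.1 V b := rfl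
    have h4 (c : Sec f V.1) : KSModule.ofFun δ _ c = c • KSModule.unit δ _ := rfl
    rw [h1, h2, h3, h4, map_zero, zero_smul, zero_sub, smul_neg, smul_smul, smul_eq_mul]

lemma lambda_locally_surjective {V : X.Opens} (s : Omega f V) (x : X) (hx : x ∈ V) :
    ∃ (W : X.Opens) (h : W ≤ V) (_ : x ∈ W) (t : OmegaTau δ f W),
      lambdaApp δ f W t = resOmega f h s := by
  obtain ⟨W, hWV, hxW, w, hw⟩ := exists_toSheafify_eq (omegaPre f) s x hx
  obtain ⟨v, rfl⟩ := KSModule.toKaehler_surjective (δ := δ) w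
  exact ⟨W, hWV, hxW, omegaTauOf δ f W v, (lambdaApp_omegaTauOf W v).trans hw⟩

end Forms

/-! ### Exactness of `0 → O_X → Ω^τ_{X/K} → Ω_{X/K} → 0`. -/

section ShortExact

variable {K : Type u} [CommRing K] (δ : Derivation ℤ K K) {X : Scheme.{u}}
  (f : X ⟶ Spec (.of K)) [Smooth f]

/-- If `ι(a)` vanishes in the associated sheaf, it vanishes in the presheaf near each point. After
shrinking to an affine open, `δ` extends by smoothness, and the retraction of
`KSModule.ofFun_injective` gives `a = 0` there. -/
lemma iotaApp_injective (V : X.Opens) : Function.Injective (iotaApp δ f V) := by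
  refine (injective_iff_map_eq_zero _).2 fun a ha => sec_ext f fun x hx => ?_
  obtain ⟨W, hWV, hxW, h⟩ := exists_map_eq_of_toSheafify_eq (omegaTauPre δ f)
    (v := KSModule.ofFun δ _ a) (w := 0) (ha.trans (map_zero (omegaTauOf δ f V)).symm) x hx
  have h : KSModule.map (res f hWV) (KSModule.ofFun δ _ a) = 0 := h.trans (map_zero _)
  obtain ⟨U, hU, hxU, hUW⟩ := (Opens.isBasis_iff_nbhd.1 X.isBasis_affineOpens) hxW
  obtain ⟨D, hD⟩ := exists_prolongation δ f hU
  refine ⟨U, hUW.trans hWV, hxU, ?_⟩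
  refine KSModule.ofFun_injective (D.1 ⟨U, le_rfl⟩) (hD ⟨U, le_rfl⟩) ?_
  have h1 : KSModule.map (res f hUW) (KSModule.map (res f hWV) (KSModule.ofFun δ _ a)) =
      KSModule.ofFun δ _ (res f (hUW.trans hWV) a) := by
    refine (congrArg _ (KSModule.map_smul_unit δ _ _)).trans
      ((KSModule.map_smul_unit δ _ _).trans ?_)
    rw [res_res]
    rfl
  rw [← h1, h, map_zero, map_zero, map_zero]

lemma exists_iotaApp_eq {V : X.Opens} {s : OmegaTau δ f V} (hs : lambdaApp δ f V s = 0) :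
    ∃ g, iotaApp δ f V g = s := by
  have key : ∀ x ∈ V, ∃ (W : X.Opens) (h : W ≤ V) (_ : x ∈ W) (g : Sec f W),
      iotaApp δ f W g = resOmegaTau δ f h s := by
    intro x hx
    obtain ⟨W, hWV, hxW, w, hw⟩ : ∃ (W : X.Opens) (h : W ≤ V) (_ : x ∈ W)
        (w : KSModule δ (Sec f W)), omegaTauOf δ f W w = resOmegaTau δ f h s :=
      exists_toSheafify_eq (omegaTauPre δ f) s x hx
    have h0 : omegaOf f W (KSModule.toKaehler δ _ w) = 0 := by
      rw [← lambdaApp_omegaTauOf, hw, ← resOmega_lambdaApp, hs, map_zero]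
    -- So far `λ(w)` vanishes only as a section of the associated sheaf; a second shrinking makes it
    -- zero in `Ω_{O(W')/K}`, where the algebraic kernel is known.
    obtain ⟨W', hW', hxW', h⟩ := exists_map_eq_of_toSheafify_eq (omegaPre f)
      (v := KSModule.toKaehler δ _ w) (w := 0) (h0.trans (map_zero (omegaOf f W)).symm) x hxW
    have h : kaehlerMap (res f hW') (KSModule.toKaehler δ _ w) = 0 := h.trans (map_zero _)
    obtain ⟨g, hg⟩ := KSModule.exists_eq_ofFun
      ((DFunLike.congr_fun (KSModule.toKaehler_map δ (res f hW')) w).trans h)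
    refine ⟨W', hW'.trans hWV, hxW', g, ?_⟩
    rw [iotaApp_eq, hg, ← resOmegaTau_omegaTauOf, hw, resOmegaTau_resOmegaTau]
  choose W hW hx g hg using key
  -- The local preimages are unique because `ι` is injective on sections, hence they agree on
  -- overlaps.
  obtain ⟨t, ht⟩ := sec_glue f (V := V) (ι := V) (fun x => W x.1 x.2) (fun x => hW x.1 x.2)
    (fun x hxV => ⟨⟨x, hxV⟩, hx x hxV⟩) (fun x => g x.1 x.2) fun x y =>
      iotaApp_injective δ f _ (by
        rw [← resOmegaTau_iotaApp, ← resOmegaTau_iotaApp, hg, hg, resOmegaTau_resOmegaTau,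
          resOmegaTau_resOmegaTau])
  refine ⟨t, section_ext (omegaTauSheaf δ f) fun x hxV => ⟨W x hxV, hW x hxV, hx x hxV, ?_⟩⟩
  refine (resOmegaTau_iotaApp (hW x hxV) t).trans ?_
  rw [ht ⟨x, hxV⟩]
  exact hg x hxV

instance : Mono (iota δ f) := by
  have : ∀ U : (Opens X)ᵒᵖ, Function.Injective ((iota δ f).hom.app U) := fun U =>
    iotaApp_injective δ f U.unop
  exact Sheaf.mono_of_injective _ this

instance : Epi (lambda δ f) := by
  refine (TopCat.Sheaf.isLocallySurjective_iff_epi (X := X) (lambda δ f)).1 ?_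
  rw [TopCat.Presheaf.isLocallySurjective_iff]
  intro V s x hx
  obtain ⟨W, h, hxW, t, ht⟩ := lambda_locally_surjective (δ := δ) (f := f) s x hx
  exact ⟨W, h, ⟨t, ht⟩, hxW⟩

lemma ksFormSeq_exact : (ksFormSeq δ f).Exact := by
  have : Mono (ksFormSeq δ f).f := inferInstanceAs (Mono (iota δ f))
  refine ShortComplex.exact_of_f_is_kernel _ (Limits.KernelFork.IsLimit.ofι' _ _
    fun {W} k hk => ?_)
  let φ (U : (Opens X)ᵒᵖ) : W.obj.obj U →+ OmegaTau δ f U.unop := (k.hom.app U).hom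
  have hφ : ∀ U w, lambdaApp δ f U.unop (φ U w) = 0 := fun U w =>
    DFunLike.congr_fun (congrArg (fun φ => (φ.hom.app U).hom) hk) w
  -- The factorization through `ι` is chosen one section at a time; injectivity of `ι` makes the
  -- choices additive and natural.
  choose ψ hψ using fun U w => exists_iotaApp_eq δ f (hφ U w)
  refine ⟨⟨{
    app U := AddCommGrpCat.ofHom (AddMonoidHom.mk' (ψ U) fun w w' =>
      iotaApp_injective δ f _ (by rw [map_add, hψ, hψ, hψ, map_add]))
    naturality U V i := ?_ }⟩, ?_⟩
  · ext w
    refine iotaApp_injective δ f V.unop ?_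
    refine (hψ V _).trans ((ConcreteCategory.congr_hom (k.hom.naturality i) w).trans ?_)
    refine Eq.trans ?_ (resOmegaTau_iotaApp i.unop.le (ψ U w))
    exact congrArg (resOmegaTau δ f i.unop.le) (hψ U w).symm
  · apply Sheaf.hom_ext
    ext U w
    exact hψ U w

lemma ksFormSeq_shortExact : (ksFormSeq δ f).ShortExact where
  exact := ksFormSeq_exact δ f
  mono_f := inferInstanceAs (Mono (iota δ f))
  epi_g := inferInstanceAs (Epi (lambda δ f))

end ShortExact

/-! ### The morphism of exact sequences given by `ω`, and the formula for the connecting map. -/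

section Contraction

variable {K : Type u} [CommRing K] (δ : Derivation ℤ K K) {X : Scheme.{u}}
  {f : X ⟶ Spec (.of K)}

/-- The map `𝒟 → Ω^τ_{X/K}` sending `(g, D)` to the image of a global form `ω` under
`a db ↦ a (g d^τ b - D(b) · 1)`. -/
noncomputable def splittingOf (ω : Omega f ⊤) : prolSheaf δ f ⟶ omegaTauSheaf δ f where
  hom :=
    { app U := AddCommGrpCat.ofHom (AddMonoidHom.mk' (fun p : ProlPair δ f U.unop =>
        splitting p ⟨U.unop, le_rfl⟩ (resOmega f le_top ω)) fun p q => splitting_add p q _ _)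
      naturality U V i := by
        ext p
        have h1 := splitting_res i.unop.le p ⟨V.unop, le_rfl⟩ (resOmega f le_top ω)
        have h2 := resOmegaTau_splitting p ⟨U.unop, le_rfl⟩ ⟨V.unop, i.unop.le⟩ i.unop.le
          (resOmega f le_top ω)
        rw [resOmega_resOmega] at h2
        exact h1.trans h2.symm }

/-- The map `O_X → Ω_{X/K}`, `g ↦ g ω`. -/
noncomputable def smulOf (ω : Omega f ⊤) : structSheaf f ⟶ omegaSheaf f where
  hom :=
    { app U := AddCommGrpCat.ofHom (AddMonoidHom.mk' (fun g : Sec f U.unop =>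
        omegaSmul g ⟨U.unop, le_rfl⟩ (resOmega f le_top ω)) fun g g' => omegaSmul_add g g' _ _)
      naturality U V i := by
        ext g
        have h1 := omegaSmul_res i.unop.le g ⟨V.unop, le_rfl⟩ (resOmega f le_top ω)
        have h2 := resOmega_omegaSmul g ⟨U.unop, le_rfl⟩ ⟨V.unop, i.unop.le⟩ i.unop.le
          (resOmega f le_top ω)
        rw [resOmega_resOmega] at h2
        exact h1.trans h2.symm }

/-- The morphism from `0 → T_{X/K} → 𝒟 → O_X → 0` to `0 → O_X → Ω^τ_{X/K} → Ω_{X/K} → 0` given by a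
global form `ω`. -/
noncomputable def prolSeqToKsFormSeq (ω : Omega f ⊤) : prolSeq δ f ⟶ ksFormSeq δ f where
  -- The sign is forced by commutativity of the left square: `(0, t)` acts as minus the contraction
  -- (`splitting_toProlPair`).
  τ₁ := -contractWith ω
  τ₂ := splittingOf δ ω
  τ₃ := smulOf ω
  comm₁₂ := by
    apply Sheaf.hom_ext
    ext U t
    refine (map_neg (iotaApp δ f U.unop) _).trans ?_
    exact (splitting_toProlPair t ⟨U.unop, le_rfl⟩ (resOmega f le_top ω)).symm
  comm₂₃ := by
    apply Sheaf.hom_ext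
    ext U p
    exact lambdaApp_splitting p ⟨U.unop, le_rfl⟩ (resOmega f le_top ω)

/-- The Kodaira–Spencer class is the connecting image of `1`, and `τ₃` sends `1` to `ω`; naturality
carries the class along `τ₁`, which is minus the contraction. -/
lemma connecting_ksFormSeq [Smooth f] (h : (ksFormSeq δ f).ShortExact) (ω : Omega f ⊤) :
    connecting h ω = -cup (kodairaSpencer δ f) ω := by
  have h1 := connecting_naturality (prolSeq_shortExact δ f) h (prolSeqToKsFormSeq δ ω)
    (1 : Sec f ⊤)
  have h2 : ((prolSeqToKsFormSeq δ ω).τ₃.hom.app (op ⊤)).hom (1 : Sec f ⊤) = ω :=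
    (omegaSmul_one ⟨⊤, le_rfl⟩ _).trans (resOmega_self ω)
  have h3 : Sheaf.H.map (-contractWith ω) 1 (kodairaSpencer δ f) =
      -cup (kodairaSpencer δ f) ω := by
    -- The map on `H¹` is additive in the sheaf map, so the maps induced by `-⟨·, ω⟩` and `⟨·, ω⟩`
    -- sum to the one induced by zero.
    rw [eq_neg_iff_add_eq_zero, cup, ← Sheaf.H.map_add_apply, neg_add_cancel,
      Sheaf.H.map_apply, Abelian.Ext.mk₀_zero, Abelian.Ext.comp_zero]
  exact ((congrArg (connecting h) h2).symm.trans h1).trans h3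

lemma exists_lambdaApp_eq_iff [Smooth f] (ω : Omega f ⊤) :
    (∃ η : OmegaTau δ f ⊤, lambdaApp δ f ⊤ η = ω) ↔ cup (kodairaSpencer δ f) ω = 0 := by
  have h := ksFormSeq_shortExact δ f
  rw [← neg_eq_zero, ← connecting_ksFormSeq δ h ω]
  exact (connecting_eq_zero_iff h ω).symm

end Contraction

/-! ### Comparison of two splittings on an overlap. -/

section Cover

variable {K : Type u} [CommRing K] {δ : Derivation ℤ K K} {X : Scheme.{u}}
  {f : X ⟶ Spec (.of K)}

/-- The pair `(1, D)` given by a derivation `D` extending `δ`. -/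
def ProlPair.ofDerFam {U : X.Opens} (D : DerFam f ℤ U)
    (hD : ∀ (V : {V : X.Opens // V ≤ U}) (c : K),
      D.1 V (algebraMap K (Sec f V.1) c) = algebraMap K (Sec f V.1) (δ c)) : ProlPair δ f U :=
  ⟨(1, D), fun V c => by rw [map_one, one_mul]; exact hD V c⟩

lemma splitting_ofDerFam_sub {U U' W : X.Opens} (h : W ≤ U) (h' : W ≤ U')
    {D : DerFam f ℤ U} {D' : DerFam f ℤ U'}
    (hD : ∀ (V : {V : X.Opens // V ≤ U}) (c : K),
      D.1 V (algebraMap K (Sec f V.1) c) = algebraMap K (Sec f V.1) (δ c))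
    (hD' : ∀ (V : {V : X.Opens // V ≤ U'}) (c : K),
      D'.1 V (algebraMap K (Sec f V.1) c) = algebraMap K (Sec f V.1) (δ c))
    {t : DerFam f K W} (ht : ∀ (V : {V : X.Opens // V ≤ W}) (a : Sec f V.1),
      t.1 V a = D.1 ⟨V.1, V.2.trans h⟩ a - D'.1 ⟨V.1, V.2.trans h'⟩ a) (w : Omega f W) :
    splitting (ProlPair.ofDerFam D hD) ⟨W, h⟩ w - splitting (ProlPair.ofDerFam D' hD') ⟨W, h'⟩ w =
      -iotaApp δ f W (contract t w) := by
  -- On `W` the pairs satisfy `(1, D) = (0, t) + (1, D')`; additivity in the pair reduces the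
  -- difference of splittings to the contribution of `(0, t)`.
  have key : ProlPair.res δ f h (ProlPair.ofDerFam D hD) =
      DerFam.toProlPair δ f W t + ProlPair.res δ f h' (ProlPair.ofDerFam D' hD') := by
    refine ProlPair.ext ?_ (Subtype.ext (funext fun V => Derivation.ext fun a => ?_))
    · change res f h 1 = 0 + res f h' 1
      rw [map_one, map_one, zero_add]
    · exact (eq_add_of_sub_eq (ht V a).symm)
  have h1 := splitting_res h (ProlPair.ofDerFam D hD) ⟨W, le_rfl⟩ w
  have h2 := splitting_res h' (ProlPair.ofDerFam D' hD') ⟨W, le_rfl⟩ w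
  have h3 := splitting_toProlPair (δ := δ) t ⟨W, le_rfl⟩ w
  rw [key, splitting_add, h2] at h1
  rw [← h1, add_sub_cancel_right, h3]
  rfl

end Cover

end KSForms

/-! ### The theorem, with the cocycle criterion for a cover. -/

theorem mainTheorem10 {K : Type u} [Field K] [CharZero K] (δ : Derivation ℤ K K)
    {X : Scheme.{u}} (f : X ⟶ Spec (.of K)) [Smooth f] (ω : KSForms.Omega f ⊤) :
    ((∃ η : KSForms.OmegaTau δ f ⊤, KSForms.lambdaApp δ f ⊤ η = ω) ↔
      KSForms.cup (KSForms.kodairaSpencer δ f) ω = 0) ∧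
    (∃ h : (KSForms.ksFormSeq δ f).ShortExact,
      KSForms.connecting h ω = -KSForms.cup (KSForms.kodairaSpencer δ f) ω) ∧
    (∀ (ι : Type u) (U : ι → X.Opens) (_ : ⨆ i, U i = ⊤)
      (D : ∀ i, KSForms.DerFam f ℤ (U i))
      (_ : ∀ i (V : {V : X.Opens // V ≤ U i}) (c : K),
        (D i).1 V (algebraMap K (KSForms.Sec f V.1) c) = algebraMap K (KSForms.Sec f V.1) (δ c))
      (t : ∀ i j, KSForms.DerFam f K (U i ⊓ U j))
      (_ : ∀ i j (V : {V : X.Opens // V ≤ U i ⊓ U j}) (a : KSForms.Sec f V.1),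
        (t i j).1 V a = (D i).1 ⟨V.1, V.2.trans inf_le_left⟩ a -
          (D j).1 ⟨V.1, V.2.trans inf_le_right⟩ a),
      (∃ σ : ∀ i (V : {V : X.Opens // V ≤ U i}), KSForms.Omega f V.1 →+ KSForms.OmegaTau δ f V.1,
        (∀ i (V W : {V : X.Opens // V ≤ U i}) (h : W.1 ≤ V.1) (w : KSForms.Omega f V.1),
          KSForms.resOmegaTau δ f h (σ i V w) = σ i W (KSForms.resOmega f h w)) ∧
        (∀ i (V : {V : X.Opens // V ≤ U i}) (a b : KSForms.Sec f V.1),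
          σ i V (KSForms.omegaOf f V.1 (a • KaehlerDifferential.D K (KSForms.Sec f V.1) b)) =
            KSForms.omegaTauOf δ f V.1
              (a • (KSForms.KSModule.dτ δ b - (D i).1 V b • KSForms.KSModule.unit δ _))) ∧
        (∀ i (V : {V : X.Opens // V ≤ U i}) (w : KSForms.Omega f V.1),
          KSForms.lambdaApp δ f V.1 (σ i V w) = w) ∧
        (∀ i j,
          σ i ⟨U i ⊓ U j, inf_le_left⟩ (KSForms.resOmega f le_top ω) -
            σ j ⟨U i ⊓ U j, inf_le_right⟩ (KSForms.resOmega f le_top ω) =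
          -KSForms.iotaApp δ f (U i ⊓ U j)
            (KSForms.contract (t i j) (KSForms.resOmega f le_top ω)))) ∧
      (KSForms.cup (KSForms.kodairaSpencer δ f) ω = 0 ↔
        ∃ g : ∀ i, KSForms.Sec f (U i), ∀ i j,
          KSForms.contract (t i j) (KSForms.resOmega f le_top ω) =
            KSForms.res f inf_le_left (g i) - KSForms.res f inf_le_right (g j))) := by
  have hlift := KSForms.exists_lambdaApp_eq_iff δ ω
  refine ⟨hlift, ⟨KSForms.ksFormSeq_shortExact δ f, KSForms.connecting_ksFormSeq δ _ ω⟩,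
    fun ι U hU D hD t ht => ?_⟩
  let p (i : ι) : KSForms.ProlPair δ f (U i) := KSForms.ProlPair.ofDerFam (D i) (hD i)
  have hsub : ∀ i j, KSForms.splitting (p i) ⟨U i ⊓ U j, inf_le_left⟩
      (KSForms.resOmega f le_top ω) - KSForms.splitting (p j) ⟨U i ⊓ U j, inf_le_right⟩
        (KSForms.resOmega f le_top ω) = -KSForms.iotaApp δ f (U i ⊓ U j)
          (KSForms.contract (t i j) (KSForms.resOmega f le_top ω)) := fun i j =>
    KSForms.splitting_ofDerFam_sub inf_le_left inf_le_right (hD i) (hD j) (ht i j) _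
  have hres : ∀ i (W : X.Opens) (h : W ≤ U i), KSForms.resOmegaTau δ f h
      (KSForms.splitting (p i) ⟨U i, le_rfl⟩ (KSForms.resOmega f le_top ω)) =
        KSForms.splitting (p i) ⟨W, h⟩ (KSForms.resOmega f le_top ω) := fun i W h => by
    have h1 := KSForms.resOmegaTau_splitting (p i) ⟨U i, le_rfl⟩ ⟨W, h⟩ h
      (KSForms.resOmega f le_top ω)
    rwa [KSForms.resOmega_resOmega] at h1
  have hlambda : ∀ i (V : {V : X.Opens // V ≤ U i}) (w : KSForms.Omega f V.1),
      KSForms.lambdaApp δ f V.1 (KSForms.splitting (p i) V w) = w := fun i V w =>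
    (KSForms.lambdaApp_splitting (p i) V w).trans (KSForms.omegaSmul_one V w)
  -- The cocycle criterion is deduced from the existence of a global lift `η`, by `hlift`, so no
  -- comparison of Čech and derived cohomology is required.
  refine ⟨⟨fun i => KSForms.splitting (p i), fun i => KSForms.resOmegaTau_splitting (p i),
    fun i V a b => ?_, hlambda, hsub⟩, hlift.symm.trans ⟨?_, ?_⟩⟩
  · have h1 : KSForms.res f V.2 (p i).1.1 = 1 := map_one (KSForms.res f V.2)
    have h2 : (p i).1.2 = D i := rfl
    rw [KSForms.splitting_smul_D, h1, h2, one_smul]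
  · rintro ⟨η, hη⟩
    -- Over `U i` both `η` and `σ_i(ω)` lift `ω`, so they differ by `ι(g_i)` for some function
    -- `g_i`.
    have hη' : ∀ i, KSForms.lambdaApp δ f (U i) (KSForms.resOmegaTau δ f le_top η -
        KSForms.splitting (p i) ⟨U i, le_rfl⟩ (KSForms.resOmega f le_top ω)) = 0 := fun i => by
      rw [map_sub, hlambda i ⟨U i, le_rfl⟩, ← KSForms.resOmega_lambdaApp, hη, sub_self]
    choose g hg using fun i => KSForms.exists_iotaApp_eq δ f (hη' i)
    refine ⟨g, fun i j => KSForms.iotaApp_injective δ f _ ?_⟩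
    -- `ι(g_i - g_j) = (η - σ_i(ω)) - (η - σ_j(ω)) = -(σ_i(ω) - σ_j(ω)) = ι⟨t_ij, ω⟩`.
    rw [map_sub, ← KSForms.resOmegaTau_iotaApp, ← KSForms.resOmegaTau_iotaApp, hg, hg, map_sub,
      map_sub, hres, hres, KSForms.resOmegaTau_resOmegaTau, KSForms.resOmegaTau_resOmegaTau,
      sub_sub_sub_cancel_left, ← neg_sub, hsub, neg_neg]
  · rintro ⟨g, hg⟩
    have hcov : ∀ x : X, ∃ i, x ∈ U i := fun x =>
      Opens.mem_iSup.1 (hU.ge (Opens.mem_top x))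
    -- The corrected local lifts `σ_i(ω) + ι(g_i)` agree on overlaps, since `σ_i(ω) - σ_j(ω) = ι(g_j
    -- - g_i)` there. The glued form lifts `ω` because `λ` kills the corrections.
    obtain ⟨η, hη⟩ := KSForms.section_glue (KSForms.omegaTauSheaf δ f) (V := ⊤) U
      (fun i => le_top) (fun x _ => hcov x)
      (fun i => KSForms.splitting (p i) ⟨U i, le_rfl⟩ (KSForms.resOmega f le_top ω) +
        KSForms.iotaApp δ f (U i) (g i)) fun i j => by
        change KSForms.resOmegaTau δ f inf_le_left _ = KSForms.resOmegaTau δ f inf_le_right _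
        rw [map_add, map_add, hres, hres, KSForms.resOmegaTau_iotaApp,
          KSForms.resOmegaTau_iotaApp]
        have h1 := hsub i j
        rw [hg, map_sub, neg_sub, sub_eq_sub_iff_add_eq_add] at h1
        exact h1.trans (add_comm _ _)
    have hη : ∀ i, KSForms.resOmegaTau δ f le_top η = KSForms.splitting (p i) ⟨U i, le_rfl⟩
      (KSForms.resOmega f le_top ω) + KSForms.iotaApp δ f (U i) (g i) := hη
    refine ⟨η, KSForms.section_ext (KSForms.omegaSheaf f) fun x _ => ?_⟩
    obtain ⟨i, hi⟩ := hcov x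
    refine ⟨U i, le_top, hi, (KSForms.resOmega_lambdaApp le_top η).trans ?_⟩
    rw [hη i, map_add, hlambda i ⟨U i, le_rfl⟩, KSForms.lambdaApp_iotaApp, add_zero]
    rfl
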